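/- Let $k$ be an algebraically closed field of characteristic $p>0$, let $0<d<n$, and let $G\cong\mathbb G_m^d$ be a subtorus of $T=\mathbb G_m^n$ acting on $X=\mathbb A^n$ through the coordinatewise scaling action of $T$. Let $\chi_1,\dots,\chi_n\in X^*(G)$ be the restrictions to $G$ of the coordinate characters of $T$. Assume that $\pi:X_*(T)\to X_*(T/G)$ is unimodular: any linearly independent set of vectors $\pi(e_j)$ is part of a $\mathbb Z$-basis of $X_*(T/G)$. *The number $N$.* For $\delta\in X^*(G)$ put $$P_\delta=\Big\{v\in\mathbb R_{\ge0}^{2n}:\ \sum_{j=1}^n (v_j-v_{n+j})\chi_j=\delta\Big\},$$ and let $N(\delta)$ be the largest absolute value of a coordinate of a vertex of $P_\delta$. For $I\subseteq\{1,\dots,n\}$ let $T_I\subseteq T$ be the subtorus of points whose $j$-th coordinate is $1$ for all $j\in I$; if $X_*(G)\cap X_*(T_I)$ has rank $1$, let $W_I=\{a\in X^*(G):\langle a,\,X_*(G)\cap X_*(T_I)\rangle=0\}$. Let $N$ be the minimum of $N(\delta)$ over all $\delta\in X^*(G)$ that lie in none of these walls $W_I$ and in no $\mathrm{Span}_{\mathbb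 Z}\{\chi_j\}_{j\in I}$ with $|I|<d$. *Smooth parameters.* Let $\mu:T^*X\to\mathfrak g^*$, $(x,\xi)\mapsto\sum_j x_j\xi_j\,d\chi_j$, be the moment map. Call $\delta\in X^*(G)$ a smooth parameter if $G$ acts freely on the $\delta$-semistable locus $\mu^{-1}(0)^{\delta\text{-}ss}$. *The relation $\le$.* Let $D=k\langle x_1,\dots,x_n,\partial_1,\dots,\partial_n\rangle$ be the Weyl algebra (the crystalline differential operators on $X$), on which $G$ acts with $x_j$ of weight $\chi_j$ and $\partial_j$ of weight $\chi_j^{-1}$, and let $\mu^*(\theta)=\sum_j d\chi_j(\theta)\,x_j\partial_j\in D$ for $\theta\in\mathfrak g$. For $\Lambda_1,\Lambda_2\in X^*(G)$ and $\lambda_i=d\Lambda_i$ let $$B^{\Lambda_1,\Lambda_2}=\big(D/\{\mu^*(\theta)-\lambda_1(\theta)\}_{\theta\in\mathfrak g}D\big)^{\Lambda_1\Lambda_2^{-1}}$$ be the space of $G$-semi-invariants of weight $\Lambda_1\Lambda_2^{-1}$, and let $U_{\lambda_1}=B^{\Lambda_1,\Lambda_1}$. Multiplication in $D$ makes $U_{\lambda_i}$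 an algebra and $B^{\Lambda_1,\Lambda_2}$ a $(U_{\lambda_1},U_{\lambda_2})$-bimodule. Write $\Lambda_1\le\Lambda_2$ if the multiplication map $B^{\Lambda_1,\Lambda_2}\otimes_{U_{\lambda_2}}B^{\Lambda_2,\Lambda_1}\to U_{\lambda_1}$ is surjective. **Proposition.** If $$p>\binom{n}{d-1}(2N)^{\,n-d+1},$$ then there exist a smooth parameter $\delta\in X^*(G)$ and a character $\Lambda\in X^*(G)$ such that $\Lambda\le\Lambda\delta$. -/

import Mathlib

/-!
Conventions. The torus `T = 𝔾ₘⁿ` acts on affine space `X = 𝔸ⁿ` by scaling the coordinates, and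
`G ⊆ T` is a subtorus of dimension `d`, written as `𝔾ₘᵈ` (so that `X^*(G) = X_*(G) = ℤᵈ` with the
standard pairing).  The inclusion is recorded by the weights `χ : Fin n → Fin d → ℤ`, where `χ j` is
the restriction to `G` of the `j`-th coordinate character of `T`; a point `t` of `G` is sent to the
point `(t ^ χ 1, …, t ^ χ n)` of `T`.  This map is a closed embedding iff the `χ j` span `ℤᵈ`.
Characters of `G` are written additively: `Λδ` is `Λ + δ`.
-/

namespace Hypertoric

/-! ### Characters -/

/-- The value `t ^ a` of the character `a ∈ X^*(G) = ℤᵈ` at a point `t` of `G = 𝔾ₘᵈ`. -/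
def chr {R : Type*} [CommRing R] {d : ℕ} (a : Fin d → ℤ) (t : Fin d → Rˣ) : Rˣ :=
  ∏ i, t i ^ a i

theorem chr_zero {R : Type*} [CommRing R] {d : ℕ} (t : Fin d → Rˣ) :
    chr (0 : Fin d → ℤ) t = 1 := by
  simp [chr]

theorem chr_add {R : Type*} [CommRing R] {d : ℕ} (a b : Fin d → ℤ) (t : Fin d → Rˣ) :
    chr (a + b) t = chr a t * chr b t := by
  simp [chr, zpow_add, Finset.prod_mul_distrib]

theorem chr_neg {R : Type*} [CommRing R] {d : ℕ} (a : Fin d → ℤ) (t : Fin d → Rˣ) :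
    chr (-a) t = (chr a t)⁻¹ := by
  simp [chr]

/-- The differential `da ∈ 𝔤^*` of the character `a`, evaluated at `θ ∈ 𝔤 = kᵈ`. -/
def dchr {k : Type*} [Field k] {d : ℕ} (a : Fin d → ℤ) (θ : Fin d → k) : k :=
  ∑ i, (a i : k) * θ i

theorem dchr_zero {k : Type*} [Field k] {d : ℕ} (θ : Fin d → k) :
    dchr (0 : Fin d → ℤ) θ = 0 := by
  simp [dchr]

theorem dchr_add {k : Type*} [Field k] {d : ℕ} (a b : Fin d → ℤ) (θ : Fin d → k) :
    dchr (a + b) θ = dchr a θ + dchr b θ := by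
  simp [dchr, add_mul, Finset.sum_add_distrib]

theorem dchr_neg {k : Type*} [Field k] {d : ℕ} (a : Fin d → ℤ) (θ : Fin d → k) :
    dchr (-a) θ = -dchr a θ := by
  simp [dchr]

theorem dchr_sub {k : Type*} [Field k] {d : ℕ} (a b : Fin d → ℤ) (θ : Fin d → k) :
    dchr (a - b) θ = dchr a θ - dchr b θ := by
  rw [sub_eq_add_neg, dchr_add, dchr_neg, sub_eq_add_neg]

theorem chr_injective (k : Type*) [Field k] [Infinite k] (d : ℕ) :
    Function.Injective
      (fun (a : Fin d → ℤ) (t : Fin d → kˣ) => ((chr a t : kˣ) : k)) := by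
  intro a b hab
  by_contra hne
  obtain ⟨i, hi⟩ := Function.ne_iff.mp hne
  have key : ∀ u : kˣ, u ^ (a i - b i) = 1 := by
    intro u
    have h := congrFun hab (Pi.mulSingle i u)
    have h' : chr a (Pi.mulSingle i u) = chr b (Pi.mulSingle i u) := Units.ext h
    have hc : ∀ c : Fin d → ℤ, chr c (Pi.mulSingle i u) = u ^ c i := by
      intro c
      unfold chr
      rw [Finset.prod_eq_single i]
      · simp
      · intro j _ hj
        simp [Pi.mulSingle_eq_of_ne hj]
      · simp
    rw [hc, hc] at h'
    rw [zpow_sub, h', mul_inv_cancel]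
  have hpos : 0 < (a i - b i).natAbs := Int.natAbs_pos.mpr (sub_ne_zero.mpr hi)
  have key' : ∀ u : kˣ, u ^ (a i - b i).natAbs = 1 := by
    intro u
    rcases Int.natAbs_eq (a i - b i) with h | h
    · have := key u
      rw [h] at this
      simpa using this
    · have := key u
      rw [h, zpow_neg, inv_eq_one] at this
      simpa using this
  classical
  obtain ⟨x, hx⟩ := Infinite.exists_notMem_finset
    (insert (0 : k) (Polynomial.nthRoots (a i - b i).natAbs (1 : k)).toFinset)
  have hx0 : x ≠ 0 := by
    rintro rfl
    exact hx (Finset.mem_insert_self _ _)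
  apply hx
  refine Finset.mem_insert_of_mem ?_
  rw [Multiset.mem_toFinset, Polynomial.mem_nthRoots hpos]
  have := congrArg (fun u : kˣ => (u : k)) (key' (Units.mk0 x hx0))
  simpa using this

/-! ### Differential operators on affine space -/

/-- The relations of the Weyl algebra; `Sum.inl j` stands for `x_j`, `Sum.inr j` for `∂_j`. -/
inductive WeylRel (k : Type*) [Field k] (n : ℕ) :
    FreeAlgebra k (Fin n ⊕ Fin n) → FreeAlgebra k (Fin n ⊕ Fin n) → Prop
  | xx (i j : Fin n) : WeylRel k n
      (FreeAlgebra.ι k (Sum.inl i) * FreeAlgebra.ι k (Sum.inl j))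
      (FreeAlgebra.ι k (Sum.inl j) * FreeAlgebra.ι k (Sum.inl i))
  | dd (i j : Fin n) : WeylRel k n
      (FreeAlgebra.ι k (Sum.inr i) * FreeAlgebra.ι k (Sum.inr j))
      (FreeAlgebra.ι k (Sum.inr j) * FreeAlgebra.ι k (Sum.inr i))
  | dx (i j : Fin n) : WeylRel k n
      (FreeAlgebra.ι k (Sum.inr i) * FreeAlgebra.ι k (Sum.inl j))
      (FreeAlgebra.ι k (Sum.inl j) * FreeAlgebra.ι k (Sum.inr i) + if i = j then 1 else 0)

/-- The algebra `𝒟_X(X)` of crystalline differential operators on `X = 𝔸ⁿ`, that is the Weyl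
algebra `k⟨x₁, …, xₙ, ∂₁, …, ∂ₙ⟩`. -/
def Weyl (k : Type*) [Field k] (n : ℕ) : Type _ := RingQuot (WeylRel k n)

instance (k : Type*) [Field k] (n : ℕ) : Ring (Weyl k n) :=
  inferInstanceAs (Ring (RingQuot (WeylRel k n)))

instance (k : Type*) [Field k] (n : ℕ) : Algebra k (Weyl k n) :=
  inferInstanceAs (Algebra k (RingQuot (WeylRel k n)))

/-- The presentation of the Weyl algebra, as a quotient map from the free algebra. -/
def weylMk (k : Type*) [Field k] (n : ℕ) : FreeAlgebra k (Fin n ⊕ Fin n) →ₐ[k] Weyl k n :=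
  RingQuot.mkAlgHom k (WeylRel k n)

theorem weylMk_surjective (k : Type*) [Field k] (n : ℕ) : Function.Surjective (weylMk k n) :=
  RingQuot.mkAlgHom_surjective k (WeylRel k n)

theorem weylMk_rel (k : Type*) [Field k] {n : ℕ} {a b : FreeAlgebra k (Fin n ⊕ Fin n)}
    (h : WeylRel k n a b) : weylMk k n a = weylMk k n b :=
  RingQuot.mkAlgHom_rel k h

/-- The universal property of the presentation. -/
def weylLift {k : Type*} [Field k] {n : ℕ} {A : Type*} [Semiring A] [Algebra k A]
    (f : FreeAlgebra k (Fin n ⊕ Fin n) →ₐ[k] A) (h : ∀ ⦃a b⦄, WeylRel k n a b → f a = f b) :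
    Weyl k n →ₐ[k] A :=
  RingQuot.liftAlgHom k ⟨f, h⟩

theorem weylLift_mk {k : Type*} [Field k] {n : ℕ} {A : Type*} [Semiring A] [Algebra k A]
    (f : FreeAlgebra k (Fin n ⊕ Fin n) →ₐ[k] A) (h : ∀ ⦃a b⦄, WeylRel k n a b → f a = f b)
    (a : FreeAlgebra k (Fin n ⊕ Fin n)) : weylLift f h (weylMk k n a) = f a :=
  RingQuot.liftAlgHom_mkAlgHom_apply k f h a

/-- The generators: `gen (Sum.inl j) = x_j` and `gen (Sum.inr j) = ∂_j`. -/
def gen (k : Type*) [Field k] {n : ℕ} (c : Fin n ⊕ Fin n) : Weyl k n :=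
  weylMk k n (FreeAlgebra.ι k c)

theorem gen_xx (k : Type*) [Field k] {n : ℕ} (i j : Fin n) :
    gen k (Sum.inl i) * gen k (Sum.inl j) = gen k (Sum.inl j) * gen k (Sum.inl i) := by
  simpa [gen] using weylMk_rel k (WeylRel.xx (k := k) i j)

theorem gen_dd (k : Type*) [Field k] {n : ℕ} (i j : Fin n) :
    gen k (Sum.inr i) * gen k (Sum.inr j) = gen k (Sum.inr j) * gen k (Sum.inr i) := by
  simpa [gen] using weylMk_rel k (WeylRel.dd (k := k) i j)

theorem gen_dx (k : Type*) [Field k] {n : ℕ} (i j : Fin n) :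
    gen k (Sum.inr i) * gen k (Sum.inl j)
      = gen k (Sum.inl j) * gen k (Sum.inr i) + if i = j then 1 else 0 := by
  have := weylMk_rel k (WeylRel.dx (k := k) i j)
  split_ifs at this ⊢ <;> simpa [gen] using this

/-- A submodule of the Weyl algebra that contains `1` and is stable under right multiplication by
the generators is everything. -/
theorem weyl_induction {k : Type*} [Field k] {n : ℕ} (S : Submodule k (Weyl k n))
    (one : (1 : Weyl k n) ∈ S) (mul : ∀ P ∈ S, ∀ c, P * gen k c ∈ S) : S = ⊤ := by
  have h : ∀ a : FreeAlgebra k (Fin n ⊕ Fin n), ∀ P ∈ S,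
      P * weylMk k n a ∈ S := by
    intro a
    induction a using FreeAlgebra.induction with
    | grade0 r =>
      intro P hP
      rw [AlgHom.commutes, ← Algebra.commutes, ← Algebra.smul_def]
      exact S.smul_mem r hP
    | grade1 c => exact fun P hP => mul P hP c
    | mul a b ha hb =>
      intro P hP
      rw [map_mul, ← mul_assoc]
      exact hb _ (ha _ hP)
    | add a b ha hb =>
      intro P hP
      rw [map_add, mul_add]
      exact S.add_mem (ha _ hP) (hb _ hP)
  rw [eq_top_iff]
  intro P _
  obtain ⟨a, rfl⟩ := weylMk_surjective k n P
  simpa using h a 1 one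

/-- The weight of a generator: `x_j` has weight `χ j` and `∂_j` has weight `-χ j`. -/
def weight {n d : ℕ} (χ : Fin n → Fin d → ℤ) : Fin n ⊕ Fin n → Fin d → ℤ :=
  Sum.elim χ (fun j => -χ j)

/-- The action of `G` on `𝒟_X(X)` by algebra automorphisms: `t • x_j = t ^ χ j • x_j` and
`t • ∂_j = t ^ (-χ j) • ∂_j`. -/
def act {k : Type*} [Field k] {n d : ℕ} (χ : Fin n → Fin d → ℤ) (t : Fin d → kˣ) :
    Weyl k n →ₐ[k] Weyl k n :=
  weylLift (FreeAlgebra.lift k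
    (fun c => ((chr (weight χ c) t : kˣ) : k) • gen k c)) (by
      intro a b h
      induction h with
      | xx i j => simp [gen_xx k i j, mul_comm (chr (weight χ (Sum.inl i)) t : k), smul_smul]
      | dd i j => simp [gen_dd k i j, mul_comm (chr (weight χ (Sum.inr i)) t : k), smul_smul]
      | dx i j =>
        simp only [map_mul, FreeAlgebra.lift_ι_apply, smul_mul_smul_comm, gen_dx k i j, map_add,
          smul_add]
        rw [mul_comm (chr (weight χ (Sum.inl j)) t : k)]
        congr 1
        split_ifs with hij
        · subst hij
          simp [weight, chr_neg]
        · simp)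

theorem act_gen {k : Type*} [Field k] {n d : ℕ} (χ : Fin n → Fin d → ℤ) (t : Fin d → kˣ)
    (c : Fin n ⊕ Fin n) : act χ t (gen k c) = ((chr (weight χ c) t : kˣ) : k) • gen k c := by
  simp [act, gen, weylLift_mk]

/-- The quantum comoment map `μ^* : 𝔤 → 𝒟_X(X)`, `θ ↦ ∑_j dχ_j(θ) x_j ∂_j`, the differential of
the action of `G` on functions. -/
def comoment {k : Type*} [Field k] {n d : ℕ} (χ : Fin n → Fin d → ℤ) (θ : Fin d → k) : Weyl k n :=
  ∑ j, dchr (χ j) θ • (gen k (Sum.inl j) * gen k (Sum.inr j))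

theorem act_comoment {k : Type*} [Field k] {n d : ℕ} (χ : Fin n → Fin d → ℤ) (t : Fin d → kˣ)
    (θ : Fin d → k) : act χ t (comoment χ θ) = comoment χ θ := by
  simp [comoment, act_gen, weight, chr_neg]

theorem comoment_gen {k : Type*} [Field k] {n d : ℕ} (χ : Fin n → Fin d → ℤ) (θ : Fin d → k)
    (c : Fin n ⊕ Fin n) :
    comoment χ θ * gen k c - gen k c * comoment χ θ = dchr (weight χ c) θ • gen k c := by
  have hx : ∀ i j : Fin n, gen k (Sum.inl j) * gen k (Sum.inr j) * gen k (Sum.inl i)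
      - gen k (Sum.inl i) * (gen k (Sum.inl j) * gen k (Sum.inr j))
      = if j = i then gen k (Sum.inl i) else 0 := by
    intro i j
    rw [mul_assoc, gen_dx, ← mul_assoc (gen k (Sum.inl i)), gen_xx k i j, mul_add, ← mul_assoc,
      add_sub_cancel_left]
    split_ifs with h
    · rw [h, mul_one]
    · simp
  have hd : ∀ i j : Fin n, gen k (Sum.inl j) * gen k (Sum.inr j) * gen k (Sum.inr i)
      - gen k (Sum.inr i) * (gen k (Sum.inl j) * gen k (Sum.inr j))
      = if j = i then -gen k (Sum.inr i) else 0 := by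
    intro i j
    rw [← mul_assoc (gen k (Sum.inr i)), gen_dx, mul_assoc, gen_dd k j i, add_mul, ← mul_assoc]
    by_cases h : i = j
    · simp [h]
    · simp [h, Ne.symm h]
  unfold comoment
  rw [Finset.sum_mul, Finset.mul_sum, ← Finset.sum_sub_distrib]
  rcases c with i | i
  · simp only [smul_mul_assoc, mul_smul_comm, ← smul_sub, hx]
    simp [weight]
  · simp only [smul_mul_assoc, mul_smul_comm, ← smul_sub, hd]
    simp [weight, dchr_neg]

/-- Operators of weight `a`, both for `G` and for its Lie algebra. -/
def weightSpace {n d : ℕ} (k : Type*) [Field k] (χ : Fin n → Fin d → ℤ) (a : Fin d → ℤ) :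
    Submodule k (Weyl k n) where
  carrier := {P | (∀ t, act χ t P = ((chr a t : kˣ) : k) • P) ∧
    ∀ θ, comoment χ θ * P - P * comoment χ θ = dchr a θ • P}
  zero_mem' := by simp
  add_mem' := by
    rintro P Q ⟨hP, hP'⟩ ⟨hQ, hQ'⟩
    refine ⟨fun t => by rw [map_add, hP, hQ, smul_add], fun θ => ?_⟩
    rw [smul_add, ← hP', ← hQ']
    noncomm_ring
  smul_mem' := by
    rintro r P ⟨hP, hP'⟩
    refine ⟨fun t => by rw [map_smul, hP, smul_comm], fun θ => ?_⟩
    rw [smul_comm, ← hP', smul_sub, mul_smul_comm, smul_mul_assoc]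

theorem weightSpace_mul_gen {k : Type*} [Field k] {n d : ℕ} (χ : Fin n → Fin d → ℤ)
    {a : Fin d → ℤ} {P : Weyl k n} (hP : P ∈ weightSpace k χ a) (c : Fin n ⊕ Fin n) :
    P * gen k c ∈ weightSpace k χ (a + weight χ c) := by
  refine ⟨fun t => ?_, fun θ => ?_⟩
  · rw [map_mul, hP.1, act_gen, smul_mul_smul_comm, chr_add, Units.val_mul]
  · have h1 := hP.2 θ
    have h2 := comoment_gen χ θ c
    rw [dchr_add, add_smul, ← smul_mul_assoc, ← h1, ← mul_smul_comm (dchr (weight χ c) θ), ← h2]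
    simp only [mul_sub, sub_mul, mul_assoc]
    abel

theorem iSup_weightSpace {k : Type*} [Field k] {n d : ℕ} (χ : Fin n → Fin d → ℤ) :
    ⨆ a, weightSpace k χ a = ⊤ := by
  apply weyl_induction
  · refine Submodule.mem_iSup_of_mem 0 ⟨fun t => by simp [chr_zero], fun θ => by simp [dchr_zero]⟩
  · intro P hP c
    let L : Weyl k n →ₗ[k] Weyl k n := LinearMap.mulRight k (gen k c)
    have hle : ⨆ a, weightSpace k χ a ≤ (⨆ a, weightSpace k χ a).comap L := by
      refine iSup_le fun a Q hQ => ?_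
      exact Submodule.mem_iSup_of_mem _ (weightSpace_mul_gen χ hQ c)
    exact hle hP

/-! ### Transfer bimodules -/

/-- The right ideal `{μ^*(θ) - λ(θ)}_{θ ∈ 𝔤} 𝒟_X(X)` for `λ = dΛ`. -/
def rightIdeal (k : Type*) [Field k] {n d : ℕ} (χ : Fin n → Fin d → ℤ) (Λ : Fin d → ℤ) :
    Submodule k (Weyl k n) :=
  Submodule.span k
    {Q | ∃ θ P, Q = (comoment χ θ - algebraMap k (Weyl k n) (dchr Λ θ)) * P}

theorem rightIdeal_mul_mem {k : Type*} [Field k] {n d : ℕ} (χ : Fin n → Fin d → ℤ)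
    {Λ : Fin d → ℤ} {P : Weyl k n} (hP : P ∈ rightIdeal k χ Λ) (Q : Weyl k n) :
    P * Q ∈ rightIdeal k χ Λ := by
  have hle : rightIdeal k χ Λ ≤ (rightIdeal k χ Λ).comap (LinearMap.mulRight k Q) := by
    refine Submodule.span_le.mpr ?_
    rintro _ ⟨θ, R, rfl⟩
    exact Submodule.subset_span ⟨θ, R * Q, by simp [mul_assoc]⟩
  exact hle hP

theorem rightIdeal_act {k : Type*} [Field k] {n d : ℕ} (χ : Fin n → Fin d → ℤ)
    (Λ : Fin d → ℤ) (t : Fin d → kˣ) :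
    rightIdeal k χ Λ ≤ (rightIdeal k χ Λ).comap (act χ t).toLinearMap := by
  refine Submodule.span_le.mpr ?_
  rintro _ ⟨θ, R, rfl⟩
  exact Submodule.subset_span ⟨θ, act χ t R, by simp [act_comoment]⟩

/-- The quotient `𝒟_X(X) / {μ^*(θ) - λ(θ)}_{θ ∈ 𝔤} 𝒟_X(X)` for `λ = dΛ`. -/
def DQuot (k : Type*) [Field k] {n d : ℕ} (χ : Fin n → Fin d → ℤ) (Λ : Fin d → ℤ) : Type _ :=
  Weyl k n ⧸ rightIdeal k χ Λ

instance (k : Type*) [Field k] {n d : ℕ} (χ : Fin n → Fin d → ℤ) (Λ : Fin d → ℤ) :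
    AddCommGroup (DQuot k χ Λ) :=
  inferInstanceAs (AddCommGroup (Weyl k n ⧸ rightIdeal k χ Λ))

instance (k : Type*) [Field k] {n d : ℕ} (χ : Fin n → Fin d → ℤ) (Λ : Fin d → ℤ) :
    Module k (DQuot k χ Λ) :=
  inferInstanceAs (Module k (Weyl k n ⧸ rightIdeal k χ Λ))

/-- The class of an operator in the quotient. -/
def cls {k : Type*} [Field k] {n d : ℕ} (χ : Fin n → Fin d → ℤ) (Λ : Fin d → ℤ) :
    Weyl k n →ₗ[k] DQuot k χ Λ :=
  (rightIdeal k χ Λ).mkQ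

theorem cls_surjective {k : Type*} [Field k] {n d : ℕ} (χ : Fin n → Fin d → ℤ) (Λ : Fin d → ℤ) :
    Function.Surjective (cls (k := k) χ Λ) :=
  (rightIdeal k χ Λ).mkQ_surjective

theorem cls_eq_zero {k : Type*} [Field k] {n d : ℕ} (χ : Fin n → Fin d → ℤ) (Λ : Fin d → ℤ)
    {P : Weyl k n} : cls χ Λ P = 0 ↔ P ∈ rightIdeal k χ Λ :=
  Submodule.Quotient.mk_eq_zero _

/-- Linear maps out of the quotient. -/
def clsLift {k : Type*} [Field k] {n d : ℕ} (χ : Fin n → Fin d → ℤ) (Λ : Fin d → ℤ)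
    {M : Type*} [AddCommGroup M] [Module k M] (f : Weyl k n →ₗ[k] M)
    (h : ∀ P ∈ rightIdeal k χ Λ, f P = 0) : DQuot k χ Λ →ₗ[k] M :=
  (rightIdeal k χ Λ).liftQ f h

theorem clsLift_cls {k : Type*} [Field k] {n d : ℕ} (χ : Fin n → Fin d → ℤ) (Λ : Fin d → ℤ)
    {M : Type*} [AddCommGroup M] [Module k M] (f : Weyl k n →ₗ[k] M)
    (h : ∀ P ∈ rightIdeal k χ Λ, f P = 0) (P : Weyl k n) :
    clsLift χ Λ f h (cls χ Λ P) = f P :=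
  rfl

/-- The induced action of `G` on the quotient. -/
def actQuot {k : Type*} [Field k] {n d : ℕ} (χ : Fin n → Fin d → ℤ) (Λ : Fin d → ℤ)
    (t : Fin d → kˣ) : DQuot k χ Λ →ₗ[k] DQuot k χ Λ :=
  clsLift χ Λ ((cls χ Λ).comp (act χ t).toLinearMap)
    (fun _ hP => (cls_eq_zero χ Λ).mpr (rightIdeal_act χ Λ t hP))

theorem actQuot_cls {k : Type*} [Field k] {n d : ℕ} (χ : Fin n → Fin d → ℤ) (Λ : Fin d → ℤ)
    (t : Fin d → kˣ) (P : Weyl k n) : actQuot χ Λ t (cls χ Λ P) = cls χ Λ (act χ t P) :=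
  rfl

/-- The semi-invariants of weight `a` in the quotient `DQuot k χ Λ`. -/
def semiInv (k : Type*) [Field k] {n d : ℕ} (χ : Fin n → Fin d → ℤ) (Λ a : Fin d → ℤ) :
    Submodule k (DQuot k χ Λ) where
  carrier := {v | ∀ t : Fin d → kˣ, actQuot χ Λ t v = ((chr a t : kˣ) : k) • v}
  zero_mem' := by simp
  add_mem' := by
    intro v w hv hw t
    rw [map_add, hv, hw, smul_add]
  smul_mem' := by
    intro r v hv t
    rw [map_smul, hv, smul_comm]

/-- The transfer bimodule `B^{Λ₁, Λ₂}`: the semi-invariants of weight `Λ₁Λ₂⁻¹` in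
`𝒟_X(X) / {μ^*(θ) - λ₁(θ)}_{θ ∈ 𝔤} 𝒟_X(X)`, where `λ₁ = dΛ₁`. -/
abbrev B (k : Type*) [Field k] {n d : ℕ} (χ : Fin n → Fin d → ℤ) (Λ₁ Λ₂ : Fin d → ℤ) :
    Submodule k (DQuot k χ Λ₁) :=
  semiInv k χ Λ₁ (Λ₁ - Λ₂)

/-- The hypertoric enveloping algebra `U_λ = (𝒟_X(X) / {μ^*(θ) - λ(θ)} 𝒟_X(X))^G`, `λ = dΛ`
(as a vector space; its multiplication is `mulB χ Λ Λ Λ`). -/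
abbrev U (k : Type*) [Field k] {n d : ℕ} (χ : Fin n → Fin d → ℤ) (Λ : Fin d → ℤ) :
    Submodule k (DQuot k χ Λ) :=
  B k χ Λ Λ

theorem iSupIndep_semiInv (k : Type*) [Field k] [Infinite k] {n d : ℕ} (χ : Fin n → Fin d → ℤ)
    (Λ : Fin d → ℤ) : iSupIndep (semiInv k χ Λ) := by
  have hact : ∀ s t : Fin d → kˣ, Commute (actQuot (k := k) χ Λ s) (actQuot (k := k) χ Λ t) := by
    intro s t
    have h : ∀ P : Weyl k n, act χ s (act χ t P) = act χ t (act χ s P) := by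
      intro P
      have hP : P ∈ ⨆ a, weightSpace k χ a := by
        rw [iSup_weightSpace]
        trivial
      induction hP using Submodule.iSup_induction' with
      | mem a Q hQ => simp [hQ.1, smul_comm ((chr a s : kˣ) : k)]
      | zero => simp
      | add Q R _ _ hQ hR => simp [hQ, hR]
    refine LinearMap.ext fun v => ?_
    obtain ⟨P, rfl⟩ := cls_surjective χ Λ v
    simp [actQuot_cls, h]
  have key := Module.End.independent_iInf_maxGenEigenspace_of_forall_mapsTo
    (fun t : Fin d → kˣ => actQuot (k := k) χ Λ t)
    (fun s t φ => Module.End.mapsTo_maxGenEigenspace_of_comm (hact t s) φ)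
  refine (key.comp (chr_injective k d)).mono fun a v hv => ?_
  refine (Submodule.mem_iInf _).mpr fun t => ?_
  have h1 : v ∈ Module.End.eigenspace (actQuot (k := k) χ Λ t) ((chr a t : kˣ) : k) :=
    Module.End.mem_eigenspace_iff.mpr (hv t)
  exact Module.End.genEigenspace_le_maximal _ _ 1 h1

/-- Semi-invariants of the quotient lift to operators of the same weight. -/
theorem semiInv_lift {k : Type*} [Field k] [Infinite k] {n d : ℕ} (χ : Fin n → Fin d → ℤ)
    {Λ a : Fin d → ℤ} {v : DQuot k χ Λ} (hv : v ∈ semiInv k χ Λ a) :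
    ∃ P ∈ weightSpace k χ a, (cls χ Λ) P = v := by
  have hmap : ∀ b, (weightSpace k χ b) ≤ (semiInv k χ Λ b).comap (cls χ Λ) := by
    intro b P hP t
    have := congrArg (cls χ Λ) (hP.1 t)
    simpa [actQuot_cls] using this
  obtain ⟨P, rfl⟩ := cls_surjective χ Λ v
  have hP : P ∈ weightSpace k χ a ⊔ ⨆ b, ⨆ (_ : b ≠ a), weightSpace k χ b := by
    have hle : ⨆ b, weightSpace k χ b
        ≤ weightSpace k χ a ⊔ ⨆ b, ⨆ (_ : b ≠ a), weightSpace k χ b := by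
      refine iSup_le fun b => ?_
      by_cases hb : b = a
      · subst hb
        exact le_sup_left
      · exact le_sup_of_le_right (le_iSup₂_of_le b hb le_rfl)
    apply hle
    rw [iSup_weightSpace]
    trivial
  obtain ⟨Q, hQ, R, hR, rfl⟩ := Submodule.mem_sup.mp hP
  refine ⟨Q, hQ, ?_⟩
  have hR' : (cls χ Λ) R ∈ ⨆ b, ⨆ (_ : b ≠ a), semiInv k χ Λ b := by
    have hle : ⨆ b, ⨆ (_ : b ≠ a), weightSpace k χ b
        ≤ (⨆ b, ⨆ (_ : b ≠ a), semiInv k χ Λ b).comap (cls χ Λ) :=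
      iSup₂_le fun b hb => (hmap b).trans
        (Submodule.comap_mono (le_iSup₂_of_le b hb le_rfl))
    exact hle hR
  have hR'' : (cls χ Λ) R ∈ semiInv k χ Λ a := by
    have h := (semiInv k χ Λ a).sub_mem hv (hmap a hQ)
    rwa [map_add, add_sub_cancel_left] at h
  have h0 := Submodule.disjoint_def.mp (iSupIndep_semiInv k χ Λ a) _ hR'' hR'
  rw [map_add, h0, add_zero]

/-- The right action of operators on the quotient, `(P̄, Q) ↦ class of P Q`. -/
def rmul {k : Type*} [Field k] {n d : ℕ} (χ : Fin n → Fin d → ℤ) (Λ : Fin d → ℤ) :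
    DQuot k χ Λ →ₗ[k] Weyl k n →ₗ[k] DQuot k χ Λ :=
  clsLift χ Λ ((LinearMap.mul k (Weyl k n)).compr₂ (cls χ Λ)) (by
    intro P hP
    refine LinearMap.ext fun Q => ?_
    simpa using (cls_eq_zero χ Λ).mpr (rightIdeal_mul_mem χ hP Q))

theorem rmul_mk {k : Type*} [Field k] {n d : ℕ} (χ : Fin n → Fin d → ℤ) (Λ : Fin d → ℤ)
    (P Q : Weyl k n) :
    rmul χ Λ ((cls χ Λ) P) Q = (cls χ Λ) (P * Q) := rfl

theorem mul_mem_rightIdeal {k : Type*} [Field k] {n d : ℕ} (χ : Fin n → Fin d → ℤ)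
    {Λ₁ Λ₂ : Fin d → ℤ} {P : Weyl k n} (hP : P ∈ weightSpace k χ (Λ₁ - Λ₂)) {Q : Weyl k n}
    (hQ : Q ∈ rightIdeal k χ Λ₂) : P * Q ∈ rightIdeal k χ Λ₁ := by
  have hle : rightIdeal k χ Λ₂ ≤ (rightIdeal k χ Λ₁).comap (LinearMap.mulLeft k P) := by
    refine Submodule.span_le.mpr ?_
    rintro _ ⟨θ, R, rfl⟩
    refine Submodule.subset_span ⟨θ, P * R, ?_⟩
    have h := hP.2 θ
    have h' : P * comoment χ θ = comoment χ θ * P - dchr (Λ₁ - Λ₂) θ • P := by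
      rw [← h]
      abel
    rw [LinearMap.mulLeft_apply, ← mul_assoc, mul_sub, h', dchr_sub, ← mul_assoc, sub_mul,
      ← Algebra.commutes, ← Algebra.smul_def, sub_mul, sub_mul, ← Algebra.smul_def, sub_smul]
    simp only [sub_mul]
    abel
  exact hle hQ

theorem rmul_eq_zero {k : Type*} [Field k] [Infinite k] {n d : ℕ} (χ : Fin n → Fin d → ℤ)
    {Λ₁ Λ₂ : Fin d → ℤ} {v : DQuot k χ Λ₁} (hv : v ∈ B k χ Λ₁ Λ₂) {Q : Weyl k n}
    (hQ : Q ∈ rightIdeal k χ Λ₂) : rmul χ Λ₁ v Q = 0 := by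
  obtain ⟨P, hP, rfl⟩ := semiInv_lift χ hv
  rw [rmul_mk]
  exact (cls_eq_zero χ Λ₁).mpr (mul_mem_rightIdeal χ hP hQ)

/-- Left multiplication by `v ∈ B^{Λ₁, Λ₂}`, `Q̄ ↦ v Q̄`, well defined on the quotient at `λ₂`. -/
def lmul {k : Type*} [Field k] [Infinite k] {n d : ℕ} (χ : Fin n → Fin d → ℤ)
    (Λ₁ Λ₂ : Fin d → ℤ) (v : B k χ Λ₁ Λ₂) : DQuot k χ Λ₂ →ₗ[k] DQuot k χ Λ₁ :=
  clsLift χ Λ₂ (rmul χ Λ₁ v) (fun _ hQ => rmul_eq_zero χ v.2 hQ)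

theorem lmul_mk {k : Type*} [Field k] [Infinite k] {n d : ℕ} (χ : Fin n → Fin d → ℤ)
    (Λ₁ Λ₂ : Fin d → ℤ) (v : B k χ Λ₁ Λ₂) (P Q : Weyl k n)
    (hP : (cls χ Λ₁) P = v) :
    lmul χ Λ₁ Λ₂ v ((cls χ Λ₂) Q) = (cls χ Λ₁) (P * Q) := by
  rw [← rmul_mk, hP]
  rfl

theorem lmul_mem {k : Type*} [Field k] [Infinite k] {n d : ℕ} (χ : Fin n → Fin d → ℤ)
    (Λ₁ Λ₂ Λ₃ : Fin d → ℤ) (v : B k χ Λ₁ Λ₂) (w : B k χ Λ₂ Λ₃) :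
    lmul χ Λ₁ Λ₂ v w ∈ B k χ Λ₁ Λ₃ := by
  obtain ⟨P, hP, hPv⟩ := semiInv_lift χ v.2
  obtain ⟨Q, hQ, hQw⟩ := semiInv_lift χ w.2
  rw [← hQw, lmul_mk χ Λ₁ Λ₂ v P Q hPv]
  intro t
  have h : act χ t (P * Q) = ((chr (Λ₁ - Λ₃) t : kˣ) : k) • (P * Q) := by
    rw [map_mul, hP.1, hQ.1, smul_mul_smul_comm, ← Units.val_mul, ← chr_add, sub_add_sub_cancel]
  have := congrArg (cls χ Λ₁) h
  simpa [actQuot_cls] using this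

/-- The multiplication `B^{Λ₁, Λ₂} × B^{Λ₂, Λ₃} → B^{Λ₁, Λ₃}`, `(P̄, Q̄) ↦ class of P Q`. It includes
the product of `U_λ` and the left and right actions of the algebras `U_λ` on the bimodules. -/
def mulB {k : Type*} [Field k] [Infinite k] {n d : ℕ} (χ : Fin n → Fin d → ℤ)
    (Λ₁ Λ₂ Λ₃ : Fin d → ℤ) : B k χ Λ₁ Λ₂ →ₗ[k] B k χ Λ₂ Λ₃ →ₗ[k] B k χ Λ₁ Λ₃ :=
  LinearMap.mk₂ k (fun v w => ⟨lmul χ Λ₁ Λ₂ v w, lmul_mem χ Λ₁ Λ₂ Λ₃ v w⟩)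
    (by
      intro v v' w
      obtain ⟨Q, hQ⟩ := cls_surjective χ Λ₂ w.1
      refine Subtype.ext ?_
      simp only [← hQ, Submodule.coe_add, lmul, clsLift_cls, map_add,
        LinearMap.add_apply])
    (by
      intro r v w
      obtain ⟨Q, hQ⟩ := cls_surjective χ Λ₂ w.1
      refine Subtype.ext ?_
      simp only [← hQ, Submodule.coe_smul, lmul, clsLift_cls,
        map_smul, LinearMap.smul_apply])
    (by
      intro v w w'
      refine Subtype.ext ?_
      simp)
    (by
      intro r v w
      refine Subtype.ext ?_
      simp)

theorem mulB_coe {k : Type*} [Field k] [Infinite k] {n d : ℕ} (χ : Fin n → Fin d → ℤ)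
    (Λ₁ Λ₂ Λ₃ : Fin d → ℤ) (v : B k χ Λ₁ Λ₂) (w : B k χ Λ₂ Λ₃) (P Q : Weyl k n)
    (hP : (cls χ Λ₁) P = v) (hQ : (cls χ Λ₂) Q = w) :
    (mulB χ Λ₁ Λ₂ Λ₃ v w : DQuot k χ Λ₁) = (cls χ Λ₁) (P * Q) := by
  rw [← lmul_mk χ Λ₁ Λ₂ v P Q hP, hQ]
  rfl

theorem mulB_assoc {k : Type*} [Field k] [Infinite k] {n d : ℕ} (χ : Fin n → Fin d → ℤ)
    (Λ₁ Λ₂ Λ₃ Λ₄ : Fin d → ℤ) (u : B k χ Λ₁ Λ₂) (v : B k χ Λ₂ Λ₃) (w : B k χ Λ₃ Λ₄) :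
    mulB χ Λ₁ Λ₃ Λ₄ (mulB χ Λ₁ Λ₂ Λ₃ u v) w = mulB χ Λ₁ Λ₂ Λ₄ u (mulB χ Λ₂ Λ₃ Λ₄ v w) := by
  obtain ⟨P, hP⟩ := cls_surjective χ Λ₁ u.1
  obtain ⟨Q, hQ⟩ := cls_surjective χ Λ₂ v.1
  obtain ⟨R, hR⟩ := cls_surjective χ Λ₃ w.1
  refine Subtype.ext ?_
  rw [mulB_coe χ Λ₁ Λ₃ Λ₄ _ w (P * Q) R (mulB_coe χ Λ₁ Λ₂ Λ₃ u v P Q hP hQ).symm hR,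
    mulB_coe χ Λ₁ Λ₂ Λ₄ u _ P (Q * R) hP (mulB_coe χ Λ₂ Λ₃ Λ₄ v w Q R hQ hR).symm, mul_assoc]

open scoped TensorProduct in
/-- The relations `b u ⊗ b' - b ⊗ u b'`, `u ∈ U_{λ₂}`, of the tensor product over `U_{λ₂}`. -/
def balanced (k : Type*) [Field k] [Infinite k] {n d : ℕ} (χ : Fin n → Fin d → ℤ)
    (Λ₁ Λ₂ : Fin d → ℤ) : Submodule k (B k χ Λ₁ Λ₂ ⊗[k] B k χ Λ₂ Λ₁) :=
  Submodule.span k {z | ∃ (b : B k χ Λ₁ Λ₂) (u : U k χ Λ₂) (b' : B k χ Λ₂ Λ₁),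
    z = mulB χ Λ₁ Λ₂ Λ₂ b u ⊗ₜ[k] b' - b ⊗ₜ[k] mulB χ Λ₂ Λ₂ Λ₁ u b'}

open scoped TensorProduct in
/-- The tensor product `B^{Λ₁, Λ₂} ⊗_{U_{λ₂}} B^{Λ₂, Λ₁}` over the noncommutative algebra `U_{λ₂}`. -/
abbrev BTensor (k : Type*) [Field k] [Infinite k] {n d : ℕ} (χ : Fin n → Fin d → ℤ)
    (Λ₁ Λ₂ : Fin d → ℤ) : Type _ :=
  (B k χ Λ₁ Λ₂ ⊗[k] B k χ Λ₂ Λ₁) ⧸ balanced k χ Λ₁ Λ₂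

/-- The multiplication map `B^{Λ₁, Λ₂} ⊗_{U_{λ₂}} B^{Λ₂, Λ₁} → U_{λ₁}`. -/
def transferMap (k : Type*) [Field k] [Infinite k] {n d : ℕ} (χ : Fin n → Fin d → ℤ)
    (Λ₁ Λ₂ : Fin d → ℤ) : BTensor k χ Λ₁ Λ₂ →ₗ[k] U k χ Λ₁ :=
  (balanced k χ Λ₁ Λ₂).liftQ (TensorProduct.lift (mulB χ Λ₁ Λ₂ Λ₁)) (by
    refine Submodule.span_le.mpr ?_
    rintro _ ⟨b, u, b', rfl⟩
    simp [mulB_assoc])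

/-- The surjection relation `Λ₁ ≤ Λ₂`. -/
def TransferLE (k : Type*) [Field k] [Infinite k] {n d : ℕ} (χ : Fin n → Fin d → ℤ)
    (Λ₁ Λ₂ : Fin d → ℤ) : Prop :=
  Function.Surjective (transferMap k χ Λ₁ Λ₂)

/-! ### Smooth parameters -/

/-- The action of `R`-points of `G` on `R`-points of `T^*X = 𝔸²ⁿ`; `Sum.inl j` indexes the
coordinate `x_j`, and `Sum.inr j` the dual coordinate `ξ_j`. -/
def actPoint {R : Type*} [CommRing R] {n d : ℕ} (χ : Fin n → Fin d → ℤ) (t : Fin d → Rˣ)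
    (y : Fin n ⊕ Fin n → R) : Fin n ⊕ Fin n → R :=
  fun c => ((chr (weight χ c) t : Rˣ) : R) * y c

/-- `R`-points of the scheme `μ⁻¹(0)`, the zero fibre of the moment map `μ : T^*X → 𝔤^*`,
`(x, ξ) ↦ ∑_j x_j ξ_j dχ_j`. -/
def zeroFibre (R : Type*) [CommRing R] {n d : ℕ} (χ : Fin n → Fin d → ℤ) :
    Set (Fin n ⊕ Fin n → R) :=
  {y | ∀ i, ∑ j, (χ j i : R) * (y (Sum.inl j) * y (Sum.inr j)) = 0}

/-- The semi-invariant functions on `T^*X` of weight `a`, `𝒪(T^*X)^a`. -/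
def semiInvFun (k : Type*) [Field k] {n d : ℕ} (χ : Fin n → Fin d → ℤ) (a : Fin d → ℤ) :
    Set (MvPolynomial (Fin n ⊕ Fin n) k) :=
  {s | ∀ t : Fin d → kˣ,
    MvPolynomial.aeval
      (fun c => MvPolynomial.C ((chr (weight χ c) t : kˣ) : k) * MvPolynomial.X c) s
      = MvPolynomial.C ((chr a t : kˣ) : k) * s}

/-- `R`-points of the open subscheme `(T^*X)^{δ-ss}` of `T^*X`, the union of the loci where some
semi-invariant function `s` of weight `δ^m`, `m > 0`, is invertible.  (As the torus `G` is linearly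
reductive, semi-invariant functions on `μ⁻¹(0)` extend to `T^*X`, so that `μ⁻¹(0)^{δ-ss}` is
`μ⁻¹(0) ∩ (T^*X)^{δ-ss}`.) -/
def semistable (k : Type*) [Field k] (R : Type*) [CommRing R] [Algebra k R] {n d : ℕ}
    (χ : Fin n → Fin d → ℤ) (δ : Fin d → ℤ) : Set (Fin n ⊕ Fin n → R) :=
  {y | Ideal.span {r : R | ∃ m : ℕ, 0 < m ∧ ∃ s ∈ semiInvFun k χ (m • δ),
    r = MvPolynomial.aeval y s} = ⊤}

/-- `δ` is a smooth parameter: the group scheme `G` acts freely on `μ⁻¹(0)^{δ-ss}`, that is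
`G(R)` acts freely on the `R`-points for every commutative `k`-algebra `R`. -/
def IsSmoothParameter.{u} (k : Type u) [Field k] {n d : ℕ} (χ : Fin n → Fin d → ℤ)
    (δ : Fin d → ℤ) : Prop :=
  ∀ (R : Type u) [CommRing R] [Algebra k R] (y : Fin n ⊕ Fin n → R),
    y ∈ zeroFibre R χ → y ∈ semistable k R χ δ →
      ∀ t : Fin d → Rˣ, actPoint χ t y = y → t = 1

/-! ### The combinatorics of the torus and the number `N` -/

/-- The map `X_*(G) → X_*(T)` induced by `G ⊆ T`. -/
def cocharMap {n d : ℕ} (χ : Fin n → Fin d → ℤ) : (Fin d → ℤ) →ₗ[ℤ] (Fin n → ℤ) :=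
  Matrix.mulVecLin (Matrix.of χ)

/-- The map `π : X_*(T) → X_*(T/G) = X_*(T)/X_*(G)` is unimodular: any linearly independent set of
its columns `π(e_j)` is part of a `ℤ`-basis of the codomain. -/
def IsUnimodular {n d : ℕ} (χ : Fin n → Fin d → ℤ) : Prop :=
  ∀ S : Set (Fin n),
    LinearIndepOn ℤ
      (fun j => (LinearMap.range (cocharMap χ)).mkQ (Pi.single j 1)) S →
    ∃ (ι : Type) (b : Module.Basis ι ℤ ((Fin n → ℤ) ⧸ LinearMap.range (cocharMap χ))),
      ∀ j ∈ S, (LinearMap.range (cocharMap χ)).mkQ (Pi.single j 1) ∈ Set.range b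

/-- The lattice `X_*(G) ∩ X_*(T_I)`, as a sublattice of `X_*(G) = ℤᵈ`; here `T_I ⊆ T` consists
of the points whose `j`-th coordinate is `1` for all `j ∈ I`. -/
def subCochar {n d : ℕ} (χ : Fin n → Fin d → ℤ) (I : Finset (Fin n)) :
    Submodule ℤ (Fin d → ℤ) where
  carrier := {b | ∀ j ∈ I, cocharMap χ b j = 0}
  zero_mem' := by simp
  add_mem' := by
    intro b c hb hc j hj
    simp [hb j hj, hc j hj]
  smul_mem' := by
    intro r b hb j hj
    rw [map_smul, Pi.smul_apply, hb j hj, smul_zero]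

/-- The wall `W_I ⊆ X^*(G)`. -/
def wall {n d : ℕ} (χ : Fin n → Fin d → ℤ) (I : Finset (Fin n)) : Set (Fin d → ℤ) :=
  {a | ∀ b ∈ subCochar χ I, a ⬝ᵥ b = 0}

/-- `δ` lies in no wall `W_I` with `rank (X_*(G) ∩ X_*(T_I)) = 1`, and in no
`Span_ℤ {χ_j}_{j ∈ I}` with `|I| < dim 𝔤`. -/
def IsGeneric {n d : ℕ} (χ : Fin n → Fin d → ℤ) (δ : Fin d → ℤ) : Prop :=
  (∀ I : Finset (Fin n), Module.finrank ℤ (subCochar χ I) = 1 → δ ∉ wall χ I) ∧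
  ∀ I : Finset (Fin n), I.card < d → δ ∉ Submodule.span ℤ (χ '' (I : Set (Fin n)))

/-- The polyhedron `P_δ`, of all `v ≥ 0` in `X^*(𝔾ₘ²ⁿ)_ℝ = ℝ²ⁿ` whose restriction
`∑_j (v_j - v_{n+j}) χ_j` to `G` is `δ`. -/
def polyhedron {n d : ℕ} (χ : Fin n → Fin d → ℤ) (δ : Fin d → ℤ) : Set (Fin n ⊕ Fin n → ℝ) :=
  {v | (∀ i, ∑ j, (v (Sum.inl j) - v (Sum.inr j)) * (χ j i : ℝ) = (δ i : ℝ)) ∧ ∀ c, 0 ≤ v c}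

/-- `N(δ)`, the largest absolute value of a coordinate of a vertex of `P_δ`. -/
noncomputable def vertexBound {n d : ℕ} (χ : Fin n → Fin d → ℤ) (δ : Fin d → ℤ) : ℝ :=
  sSup {r | ∃ v ∈ Set.extremePoints ℝ (polyhedron χ δ), ∃ c, r = |v c|}

/-- `N`, the smallest `N(δ)` for generic `δ`. -/
noncomputable def minBound {n d : ℕ} (χ : Fin n → Fin d → ℤ) : ℝ :=
  sInf {r | ∃ δ, IsGeneric χ δ ∧ r = vertexBound χ δ}

end Hypertoric

/-!
The transfer `Λ ≤ Λδ` is a statement about joint eigenvalues of the commuting Euler operators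
`x_j ∂_j`. If `δ = ∑_j a_j χ_j`, then multiplying the monomial in the `∂_j` and `x_j` of weight `-δ`
by the opposite monomial of weight `δ` gives a product of factors `x_j ∂_j - r` with
`-|a_j| ≤ r < |a_j|`. So `Λ ≤ Λδ` as soon as every solution `z` of `∑_j z_j χ_j = Λ` admits an
expansion of `δ` for which none of these factors vanishes at `z`.

Let `S` be the set of those `j` for which `z_j` is not one of the at most `2N` small residues in
`[-N, N)`. If the `χ_j` with `j ∈ S` contain a basis of the weight lattice (by unimodularity, it is
enough that they span it rationally), then expanding `δ` in that basis gives a vertex of `P_δ`, so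
that all `|a_j| ≤ N`, and no factor vanishes. Otherwise `Λ` modulo `p` is a combination of the `χ_j`
whose coefficients are small outside a set of `d - 1` indices. There are at most
`n.choose (d - 1) * (2 * N) ^ (n - d + 1) * p ^ (d - 1) < p ^ d` such combinations in `𝔽_p^d`, so
some `Λ` avoids all of them.

A generic `δ` with `N(δ) = N` is a smooth parameter: at a semistable point, the weights of the
nonvanishing coordinates span a sublattice which contains a nonzero multiple of `δ`, hence, by
genericity and unimodularity, everything.
-/

namespace Hypertoric

/-! ### Lattices -/

theorem mem_span_of_smul_mem_span {ι R M : Type*} [CommRing R] [IsDomain R] [AddCommGroup M]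
    [Module R M] (b : Module.Basis ι R M) {s : Set M} (hs : s ⊆ Set.range b) {r : R} (hr : r ≠ 0)
    {x : M} (hx : r • x ∈ Submodule.span R s) : x ∈ Submodule.span R s := by
  rw [← Set.image_preimage_eq_of_subset hs, Module.Basis.mem_span_image] at hx ⊢
  rwa [map_smul, Finsupp.support_smul_eq hr] at hx

theorem mem_span_image_of_smul_mem {ι R M : Type*} [CommRing R] [IsDomain R] [AddCommGroup M]
    [Module R M] {v : ι → M} {I J : Finset ι} (hJ : LinearIndepOn R v J)
    (hspan : Submodule.span R (v '' J) = ⊤) (hIJ : I ⊆ J) {r : R} (hr : r ≠ 0) {x : M}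
    (hx : r • x ∈ Submodule.span R (v '' I)) : x ∈ Submodule.span R (v '' I) := by
  let b : Module.Basis J R M :=
    Module.Basis.mk (v := fun j : J => v j) hJ (by rw [← hspan, Set.image_eq_range]; rfl)
  refine mem_span_of_smul_mem_span b ?_ hr hx
  rintro _ ⟨i, hi, rfl⟩
  exact ⟨⟨i, hIJ hi⟩, Module.Basis.mk_apply _ _ _⟩

theorem linearIndepOn_insert_of_smul_notMem {ι R M : Type*} [CommRing R] [AddCommGroup M]
    [Module R M] {v : ι → M} {s : Set ι} (hs : LinearIndepOn R v s) {j : ι}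
    (hj : ∀ r : R, r ≠ 0 → r • v j ∉ Submodule.span R (v '' s)) :
    LinearIndepOn R v (insert j s) := by
  have hj_zero : ∀ r : R, r • v j ∈ Submodule.span R (v '' s) → r = 0 := fun r hr =>
    of_not_not fun h => hj r h hr
  have hsingle : LinearIndepOn R v {j} := by
    rw [← Finset.coe_singleton, linearIndepOn_finset_iff]
    simpa using fun (f : ι → R) (hf : f j • v j = 0) => hj_zero (f j) (by simp [hf])
  rw [Set.insert_eq]
  refine hsingle.union hs (Submodule.disjoint_def.mpr fun x hx hxs => ?_)
  rw [Set.image_singleton] at hx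
  obtain ⟨r, rfl⟩ := Submodule.mem_span_singleton.mp hx
  rw [hj_zero r hxs, zero_smul]

theorem exists_linearIndepOn_between {ι R M : Type*} [Finite ι] [CommRing R] [Nontrivial R]
    [AddCommGroup M] [Module R M] (v : ι → M) {S : Set ι} {I : Finset ι} (hIS : ↑I ⊆ S)
    (hI : LinearIndepOn R v I) :
    ∃ J : Finset ι, I ⊆ J ∧ ↑J ⊆ S ∧ LinearIndepOn R v J ∧
      ∀ j ∈ S, ∃ r : R, r ≠ 0 ∧ r • v j ∈ Submodule.span R (v '' J) := by
  classical
  obtain ⟨J, hIJ, ⟨hJS, hJ⟩, hmax⟩ := Finite.exists_le_maximal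
    (p := fun J : Finset ι => ↑J ⊆ S ∧ LinearIndepOn R v J) ⟨hIS, hI⟩
  refine ⟨J, hIJ, hJS, hJ, fun j hjS => ?_⟩
  by_contra! hj
  have hle : insert j J ⊆ J := hmax
    ⟨by simpa [Set.insert_subset_iff] using ⟨hjS, hJS⟩,
      by simpa using linearIndepOn_insert_of_smul_notMem hJ hj⟩ (Finset.subset_insert j J)
  refine hj 1 one_ne_zero ?_
  rw [one_smul]
  exact Submodule.subset_span ⟨j, hle (Finset.mem_insert_self j J), rfl⟩

theorem mem_span_image_single_iff {ι R : Type*} [Finite ι] [DecidableEq ι] [CommRing R]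
    {s : Set ι} {x : ι → R} :
    x ∈ Submodule.span R ((fun j => Pi.single j 1) '' s) ↔ ∀ j ∉ s, x j = 0 := by
  have h := (Pi.basisFun R ι).mem_span_image (m := x) (s := s)
  simp only [Set.subset_def, SetLike.mem_coe, Finsupp.mem_support_iff, Pi.basisFun_repr] at h
  simp_rw [← Pi.basisFun_apply]
  exact h.trans (forall_congr' fun j => not_imp_comm)

theorem span_range_mkQ_single {ι R : Type*} [Finite ι] [DecidableEq ι] [CommRing R]
    (p : Submodule R (ι → R)) :
    Submodule.span R (Set.range fun j => p.mkQ (Pi.single j 1)) = ⊤ := by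
  have hsingle : Submodule.span R (Set.range fun j => (Pi.single j 1 : ι → R)) = ⊤ := by
    simp_rw [← Pi.basisFun_apply]
    exact (Pi.basisFun R ι).span_eq
  rw [Set.range_comp' p.mkQ, ← Submodule.map_span, hsingle, Submodule.map_top,
    Submodule.range_mkQ]

theorem exists_sum_smul_eq_of_mem_span {ι R M : Type*} [Fintype ι] [CommRing R] [AddCommGroup M]
    [Module R M] {v : ι → M} {I : Finset ι} {x : M} (hx : x ∈ Submodule.span R (v '' I)) :
    ∃ a : ι → R, (∀ j ∉ I, a j = 0) ∧ ∑ j, a j • v j = x := by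
  classical
  obtain ⟨c, rfl⟩ := Submodule.mem_span_image_finset_iff_exists_fun' R |>.mp hx
  exact ⟨fun j => if j ∈ I then c j else 0, fun j hj => if_neg hj, by simp [Finset.sum_ite_mem]⟩

/-! ### The weights of a unimodular torus -/

section Weights

variable {n d : ℕ} {χ : Fin n → Fin d → ℤ} {I J : Finset (Fin n)}

theorem mem_wall_of_mem_span {a : Fin d → ℤ} (ha : a ∈ Submodule.span ℤ (χ '' I)) :
    a ∈ wall χ I := by
  intro b hb
  induction ha using Submodule.span_induction with
  | mem a ha =>
    obtain ⟨j, hj, rfl⟩ := ha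
    exact hb j hj
  | zero => exact zero_dotProduct b
  | add a a' _ _ ha ha' => rw [add_dotProduct, ha, ha', add_zero]
  | smul r a _ ha => rw [smul_dotProduct, ha, smul_zero]

theorem ker_funLeft_comp_cocharMap (χ : Fin n → Fin d → ℤ) (J : Finset (Fin n)) :
    LinearMap.ker (LinearMap.funLeft ℤ ℤ ((↑) : J → Fin n) ∘ₗ cocharMap χ) = subCochar χ J := by
  ext b
  simp [funext_iff, subCochar]

theorem le_card_of_subCochar_eq_bot (hJ : subCochar χ J = ⊥) : d ≤ J.card := by
  have hinj := LinearMap.ker_eq_bot.mp ((ker_funLeft_comp_cocharMap χ J).trans hJ)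
  simpa using LinearMap.finrank_le_finrank_of_injective hinj

theorem card_le_of_linearIndepOn (hJ : LinearIndepOn ℤ χ J) : J.card ≤ d := by
  simpa using LinearIndependent.fintype_card_le_finrank hJ

theorem subCochar_eq_bot_of_smul_mem_span (hspan : Submodule.span ℤ (Set.range χ) = ⊤)
    (hJ : ∀ j, ∃ r : ℤ, r ≠ 0 ∧ r • χ j ∈ Submodule.span ℤ (χ '' J)) : subCochar χ J = ⊥ := by
  refine (Submodule.eq_bot_iff _).mpr fun b hb => ?_
  have hχb : b ∈ subCochar χ Finset.univ := fun j _ => by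
    obtain ⟨r, hr, hrj⟩ := hJ j
    have h := mem_wall_of_mem_span hrj b hb
    rw [smul_dotProduct] at h
    exact (smul_eq_zero.mp h).resolve_left hr
  refine dotProduct_eq_zero _ fun a => ?_
  rw [dotProduct_comm]
  exact mem_wall_of_mem_span (χ := χ) (I := Finset.univ) (by simp [hspan]) b hχb

theorem linearIndepOn_mkQ_single (hJ : subCochar χ J = ⊥) :
    LinearIndepOn ℤ (fun j => (LinearMap.range (cocharMap χ)).mkQ (Pi.single j 1))
      ((J : Set (Fin n))ᶜ) := by
  have hbasis : LinearIndepOn ℤ (fun j => (Pi.single j 1 : Fin n → ℤ)) (J : Set (Fin n))ᶜ :=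
    (Pi.linearIndependent_single_one (Fin n) ℤ).linearIndepOn _
  refine LinearIndependent.map hbasis (Submodule.disjoint_def.mpr fun x hx hxφ => ?_)
  rw [Submodule.ker_mkQ] at hxφ
  obtain ⟨b, rfl⟩ := hxφ
  have hx_zero := mem_span_image_single_iff.mp (by simpa only [Set.image_eq_range] using hx)
  have hb : b ∈ subCochar χ J := fun j hj => hx_zero j (by simpa using hj)
  rw [hJ, Submodule.mem_bot] at hb
  rw [hb, map_zero]

theorem finrank_quotient_range_cocharMap_add (hJ : subCochar χ J = ⊥) :
    Module.finrank ℤ ((Fin n → ℤ) ⧸ LinearMap.range (cocharMap χ)) + d = n := by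
  have hker : LinearMap.ker (cocharMap χ) = ⊥ := by
    refine le_bot_iff.mp (hJ ▸ fun b hb j _ => ?_)
    rw [LinearMap.mem_ker.mp hb, Pi.zero_apply]
  have hrank := (LinearMap.range (cocharMap χ)).finrank_quotient_add_finrank
  rwa [LinearMap.finrank_range_of_inj (LinearMap.ker_eq_bot.mp hker), Module.finrank_fin_fun,
    Module.finrank_fin_fun] at hrank

theorem span_mkQ_single_eq_top (hunimod : IsUnimodular χ) (hind : LinearIndepOn ℤ χ J)
    (hJ : subCochar χ J = ⊥) :
    Submodule.span ℤ ((fun j => (LinearMap.range (cocharMap χ)).mkQ (Pi.single j 1)) ''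
      (J : Set (Fin n))ᶜ) = ⊤ := by
  set q := fun j => (LinearMap.range (cocharMap χ)).mkQ (Pi.single j 1)
  have hindJ := linearIndepOn_mkQ_single hJ
  obtain ⟨ι, b, hb⟩ := hunimod _ hindJ
  rw [← Finset.coe_compl] at hindJ hb ⊢
  obtain ⟨K, hJK, -, hK, hsmul⟩ := exists_linearIndepOn_between q (Set.subset_univ _) hindJ
  have hKcard : K.card ≤ Module.finrank ℤ ((Fin n → ℤ) ⧸ LinearMap.range (cocharMap χ)) := by
    simpa using LinearIndependent.fintype_card_le_finrank hK
  have hKJ : Jᶜ = K := Finset.eq_of_subset_of_card_le hJK (by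
    have hrank := finrank_quotient_range_cocharMap_add hJ
    have hcard := card_le_of_linearIndepOn hind
    rw [Finset.card_compl, Fintype.card_fin]
    lia)
  have hq : ∀ j, q j ∈ Submodule.span ℤ (q '' (Jᶜ : Finset (Fin n))) := fun j => by
    obtain ⟨r, hr, hrj⟩ := hsmul j (Set.mem_univ j)
    exact mem_span_of_smul_mem_span b (Set.image_subset_iff.mpr hb) hr (hKJ ▸ hrj)
  rw [eq_top_iff, ← span_range_mkQ_single, Submodule.span_le]
  exact Set.range_subset_iff.mpr hq

theorem surjective_funLeft_comp_cocharMap (hunimod : IsUnimodular χ)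
    (hind : LinearIndepOn ℤ χ J) (hJ : subCochar χ J = ⊥) :
    Function.Surjective (LinearMap.funLeft ℤ ℤ ((↑) : J → Fin n) ∘ₗ cocharMap χ) := by
  intro w
  obtain ⟨v, rfl⟩ := LinearMap.funLeft_surjective_of_injective ℤ ℤ _ Subtype.val_injective w
  have hspan := span_mkQ_single_eq_top hunimod hind hJ
  rw [← Set.image_image, ← Submodule.map_span, Submodule.map_mkQ_eq_top] at hspan
  obtain ⟨_, ⟨b, rfl⟩, e, he, rfl⟩ :=
    Submodule.mem_sup.mp (hspan ▸ Submodule.mem_top : v ∈ _)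
  refine ⟨b, funext fun j => ?_⟩
  have hej : e j = 0 := mem_span_image_single_iff.mp he j (by simp)
  simp [LinearMap.funLeft_apply, hej]

theorem span_image_eq_top (hunimod : IsUnimodular χ) (hind : LinearIndepOn ℤ χ J)
    (hJ : subCochar χ J = ⊥) : Submodule.span ℤ (χ '' J) = ⊤ := by
  set f := LinearMap.funLeft ℤ ℤ ((↑) : J → Fin n) ∘ₗ cocharMap χ with hf
  have hinj : LinearMap.ker f = ⊥ := (ker_funLeft_comp_cocharMap χ J).trans hJ
  let e := LinearEquiv.ofBijective f
    ⟨LinearMap.ker_eq_bot.mp hinj, surjective_funLeft_comp_cocharMap hunimod hind hJ⟩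
  refine (Submodule.eq_top_iff').mpr fun a => ?_
  -- the coefficients of `a` are read off from the functional `b ↦ ⟨a, b⟩` on `ℤ^J`
  let g : (J → ℤ) →ₗ[ℤ] ℤ := dotProductBilin ℤ ℤ a ∘ₗ e.symm.toLinearMap
  have hsum : a = ∑ j : J, g (fun i => if j = i then 1 else 0) • χ j := by
    ext i
    have hg : g (e (Pi.single i 1)) = a i := by simp [g, dotProductBilin]
    have he : ∀ j, e (Pi.single i 1) j = χ j i := fun j => by simp [e, hf, cocharMap]
    rw [← hg, LinearMap.pi_apply_eq_sum_univ g]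
    simp only [he, smul_eq_mul, Finset.sum_apply, Pi.smul_apply, mul_comm]
  rw [hsum]
  exact Submodule.sum_mem _ fun j _ =>
    Submodule.smul_mem _ _ (Submodule.subset_span ⟨j, j.2, rfl⟩)

theorem exists_linearIndepOn_span_eq_top (hspan : Submodule.span ℤ (Set.range χ) = ⊤)
    (hunimod : IsUnimodular χ) (S : Set (Fin n)) :
    ∃ I J : Finset (Fin n), I ⊆ J ∧ ↑I ⊆ S ∧ J.card = d ∧ LinearIndepOn ℤ χ J ∧
      Submodule.span ℤ (χ '' J) = ⊤ ∧ ∀ j ∈ S, χ j ∈ Submodule.span ℤ (χ '' I) := by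
  obtain ⟨I, -, hIS, hI, hSI⟩ := exists_linearIndepOn_between (R := ℤ) χ (S := S) (I := ∅)
    (by simp) (by simp)
  obtain ⟨J, hIJ, -, hJ, hsmul⟩ := exists_linearIndepOn_between χ (Set.subset_univ _) hI
  have hbot : subCochar χ J = ⊥ :=
    subCochar_eq_bot_of_smul_mem_span hspan fun j => hsmul j (Set.mem_univ j)
  have htop : Submodule.span ℤ (χ '' J) = ⊤ := span_image_eq_top hunimod hJ hbot
  refine ⟨I, J, hIJ, hIS, (card_le_of_linearIndepOn hJ).antisymm (le_card_of_subCochar_eq_bot hbot),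
    hJ, htop, fun j hj => ?_⟩
  obtain ⟨r, hr, hrj⟩ := hSI j hj
  exact mem_span_image_of_smul_mem hJ htop hIJ hr hrj

end Weights

/-! ### Vertices of polyhedra -/

section Polyhedra

variable {𝕜 ι E : Type*} [Field 𝕜] [LinearOrder 𝕜] [IsStrictOrderedRing 𝕜] [AddCommGroup E]
  [Module 𝕜 E] (A : (ι → 𝕜) →ₗ[𝕜] E) (b : E)

theorem exists_one_lt_le_smul_of_support_subset [Finite ι] {v w : ι → 𝕜} (hv : 0 ≤ v)
    (hwv : Function.support w ⊆ Function.support v) : ∃ t : 𝕜, 1 < t ∧ w ≤ t • v := by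
  have h : ∀ i, ∀ᶠ t : 𝕜 in Filter.atTop, w i ≤ t * v i := fun i => by
    by_cases hvi : v i = 0
    · have hwi : w i = 0 := Function.notMem_support.mp fun hi => hwv hi hvi
      simp [hvi, hwi]
    · filter_upwards [Filter.eventually_ge_atTop (w i / v i)] with t ht
      exact (div_le_iff₀ ((hv i).lt_of_ne' hvi)).mp ht
  exact ((Filter.eventually_gt_atTop 1).and (Filter.eventually_all.mpr h)).exists

theorem eq_of_mem_extremePoints_of_support_subset [Finite ι] {v w : ι → 𝕜}
    (hv : v ∈ Set.extremePoints 𝕜 {v | A v = b ∧ 0 ≤ v}) (hAw : A w = b) (hw : 0 ≤ w)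
    (hwv : Function.support w ⊆ Function.support v) : w = v := by
  obtain ⟨⟨hAv, hv_nonneg⟩, hext⟩ := mem_extremePoints_iff_left.mp hv
  obtain ⟨t, ht, hwt⟩ := exists_one_lt_le_smul_of_support_subset hv_nonneg hwv
  have ht_sub : 0 < t - 1 := sub_pos.mpr ht
  have ht_pos : 0 < t := one_pos.trans ht
  refine hext w ⟨hAw, hw⟩ ((t - 1)⁻¹ • (t • v - w)) ⟨?_, ?_⟩ ⟨t⁻¹, t⁻¹ * (t - 1), ?_, ?_, ?_, ?_⟩
  · have hb : t • b - b = (t - 1) • b := by rw [sub_smul, one_smul]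
    rw [map_smul, map_sub, map_smul, hAv, hAw, hb, inv_smul_smul₀ ht_sub.ne']
  · exact smul_nonneg (inv_nonneg.mpr ht_sub.le) (sub_nonneg.mpr hwt)
  · positivity
  · positivity
  · field_simp
    ring
  · rw [smul_smul, mul_assoc, mul_inv_cancel₀ ht_sub.ne', mul_one, ← smul_add, add_sub_cancel,
      inv_smul_smul₀ ht_pos.ne']

theorem mem_extremePoints_of_forall_support_subset {v : ι → 𝕜} (hAv : A v = b) (hv : 0 ≤ v)
    (huniq : ∀ w, A w = b → 0 ≤ w → Function.support w ⊆ Function.support v → w = v) :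
    v ∈ Set.extremePoints 𝕜 {v | A v = b ∧ 0 ≤ v} := by
  refine mem_extremePoints_iff_left.mpr ⟨⟨hAv, hv⟩, fun x hx y hy hxy => ?_⟩
  refine huniq x hx.1 hx.2 fun i hxi hvi => hxi ?_
  obtain ⟨r, s, hr, hs, -, rfl⟩ := hxy
  have hri : r * x i + s * y i = 0 := hvi
  have hrx : 0 ≤ r * x i := mul_nonneg hr.le (hx.2 i)
  have hsy : 0 ≤ s * y i := mul_nonneg hs.le (hy.2 i)
  exact (mul_eq_zero.mp (((add_eq_zero_iff_of_nonneg hrx hsy).mp hri).1)).resolve_left hr.ne'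

theorem finite_extremePoints [Finite ι] : (Set.extremePoints 𝕜 {v | A v = b ∧ 0 ≤ v}).Finite := by
  refine Set.Finite.of_injOn (f := Function.support) (Set.mapsTo_univ _ _) ?_ Set.finite_univ
  intro v hv w hw h
  exact eq_of_mem_extremePoints_of_support_subset A b hw hv.1.1 hv.1.2 h.subset

end Polyhedra

/-- The lattice `ℤ^κ` inside `F^κ`, coordinatewise. -/
def castVec (F : Type*) [CommRing F] {κ : Type*} : (κ → ℤ) →ₗ[ℤ] (κ → F) :=
  (Algebra.linearMap ℤ F).compLeft κ

@[simp]
theorem castVec_apply {F : Type*} [CommRing F] {κ : Type*} (a : κ → ℤ) (i : κ) :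
    castVec F a i = a i :=
  rfl

theorem castVec_smul {F : Type*} [CommRing F] {κ : Type*} (r : ℤ) (a : κ → ℤ) :
    castVec F (r • a) = (r : F) • castVec F a := by
  ext i
  simp

theorem castVec_mem_span_image {F ι κ : Type*} [CommRing F] {v : ι → κ → ℤ} {s : Set ι}
    {a : κ → ℤ} (ha : a ∈ Submodule.span ℤ (v '' s)) :
    castVec F a ∈ Submodule.span F ((fun j => castVec F (v j)) '' s) := by
  have hmem := Submodule.mem_map_of_mem (f := castVec F (κ := κ)) ha
  rw [Submodule.map_span, Set.image_image] at hmem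
  exact Submodule.span_subset_span ℤ F _ hmem

theorem span_castVec_image_eq_top {F ι κ : Type*} [CommRing F] [Finite κ] {v : ι → κ → ℤ}
    {s : Set ι} (hv : Submodule.span ℤ (v '' s) = ⊤) :
    Submodule.span F ((fun j => castVec F (v j)) '' s) = ⊤ := by
  classical
  rw [eq_top_iff, ← (Pi.basisFun F κ).span_eq, Submodule.span_le]
  rintro _ ⟨i, rfl⟩
  have hsingle : Pi.basisFun F κ i = castVec F (Pi.single i 1) := by
    ext j
    simp [Pi.single_apply]
  exact hsingle ▸ castVec_mem_span_image (hv ▸ Submodule.mem_top)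

theorem linearIndepOn_castVec {F ι κ : Type*} [Field F] [Fintype κ] {v : ι → κ → ℤ}
    {J : Finset ι} (hv : Submodule.span ℤ (v '' J) = ⊤) (hJ : J.card = Fintype.card κ) :
    LinearIndepOn F (fun j => castVec F (v j)) J := by
  refine linearIndependent_of_top_le_span_of_card_eq_finrank ?_ (by simpa using hJ)
  rw [← span_castVec_image_eq_top (F := F) hv, Set.image_eq_range]

theorem eq_of_sum_smul_eq_of_linearIndepOn {ι R M : Type*} [Fintype ι] [Ring R] [AddCommGroup M]
    [Module R M] {v : ι → M} {J : Finset ι} (hv : LinearIndepOn R v J) {a b : ι → R}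
    (ha : ∀ j ∉ J, a j = 0) (hb : ∀ j ∉ J, b j = 0) (hab : ∑ j, a j • v j = ∑ j, b j • v j) :
    a = b := by
  have hsum : ∑ j ∈ J, (a - b) j • v j = 0 := by
    rw [Finset.sum_subset J.subset_univ fun j _ hj => by simp [ha j hj, hb j hj]]
    simp [sub_smul, hab]
  ext j
  by_cases hj : j ∈ J
  · exact sub_eq_zero.mp (linearIndepOn_finset_iff.mp hv _ hsum j hj)
  · rw [ha j hj, hb j hj]

/-! ### The number `N(δ)` -/

section VertexBound

variable {n d : ℕ} (χ : Fin n → Fin d → ℤ) (δ : Fin d → ℤ)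

/-- The linear map `v ↦ ∑_j (v_j - v_{n+j}) χ_j`, whose nonnegative fibres are the `P_δ`. -/
noncomputable def signedWeight : (Fin n ⊕ Fin n → ℝ) →ₗ[ℝ] (Fin d → ℝ) :=
  Fintype.linearCombination ℝ (fun j => castVec ℝ (χ j)) ∘ₗ
    (LinearMap.funLeft ℝ ℝ Sum.inl - LinearMap.funLeft ℝ ℝ Sum.inr)

theorem signedWeight_apply (v : Fin n ⊕ Fin n → ℝ) :
    signedWeight χ v = ∑ j, (v (Sum.inl j) - v (Sum.inr j)) • castVec ℝ (χ j) :=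
  rfl

theorem polyhedron_eq : polyhedron χ δ = {v | signedWeight χ v = castVec ℝ δ ∧ 0 ≤ v} := by
  ext v
  simp [polyhedron, signedWeight_apply, funext_iff, Pi.le_def]

theorem abs_le_vertexBound {v : Fin n ⊕ Fin n → ℝ}
    (hv : v ∈ Set.extremePoints ℝ (polyhedron χ δ)) (c : Fin n ⊕ Fin n) :
    |v c| ≤ vertexBound χ δ := by
  have hfin : (Set.extremePoints ℝ (polyhedron χ δ)).Finite :=
    polyhedron_eq χ δ ▸ finite_extremePoints _ _
  refine le_csSup (Set.Finite.bddAbove ?_) ⟨v, hv, c, rfl⟩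
  refine (hfin.biUnion fun w _ => Set.finite_range fun c => |w c|).subset ?_
  rintro _ ⟨w, hw, c, rfl⟩
  exact Set.mem_biUnion hw ⟨c, rfl⟩

theorem vertexBound_nonneg : 0 ≤ vertexBound χ δ := by
  refine Real.sSup_nonneg ?_
  rintro _ ⟨v, -, c, rfl⟩
  exact abs_nonneg _

/-- The point of `ℝ²ⁿ` whose two halves are the positive and negative parts of `a`: the point of
minimal support over `a` for the map `v ↦ (v_j - v_{n+j})_j`. -/
def signedPoint (a : Fin n → ℝ) : Fin n ⊕ Fin n → ℝ :=
  Sum.elim (fun j => (a j)⁺) (fun j => (a j)⁻)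

variable {χ δ}

theorem signedPoint_mem_extremePoints {J : Finset (Fin n)}
    (hJ : LinearIndepOn ℝ (fun j => castVec ℝ (χ j)) J) {a : Fin n → ℝ} (ha : ∀ j ∉ J, a j = 0)
    (hsum : ∑ j, a j • castVec ℝ (χ j) = castVec ℝ δ) :
    signedPoint a ∈ Set.extremePoints ℝ (polyhedron χ δ) := by
  rw [polyhedron_eq]
  refine mem_extremePoints_of_forall_support_subset _ _ ?_ ?_ fun w hw _ hsupp => ?_
  · simpa [signedWeight_apply, signedPoint, posPart_sub_negPart] using hsum
  · rintro (j | j)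
    · exact posPart_nonneg (a j)
    · exact negPart_nonneg (a j)
  have hinl : ∀ j, a j ≤ 0 → w (Sum.inl j) = 0 := fun j hj =>
    Function.notMem_support.mp fun hmem => hsupp hmem (posPart_eq_zero.mpr hj)
  have hinr : ∀ j, 0 ≤ a j → w (Sum.inr j) = 0 := fun j hj =>
    Function.notMem_support.mp fun hmem => hsupp hmem (negPart_eq_zero.mpr hj)
  have hdiff : (fun j => w (Sum.inl j) - w (Sum.inr j)) = a :=
    eq_of_sum_smul_eq_of_linearIndepOn hJ
      (fun j hj => by rw [hinl j (ha j hj).le, hinr j (ha j hj).ge, sub_zero]) ha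
      (hw.trans hsum.symm)
  ext (j | j)
  all_goals
    have hj := congrFun hdiff j
    rcases le_total (a j) 0 with h | h
  · rw [hinl j h, signedPoint, Sum.elim_inl, posPart_eq_zero.mpr h]
  · rw [signedPoint, Sum.elim_inl, posPart_eq_self.mpr h, ← hj, hinr j h, sub_zero]
  · rw [signedPoint, Sum.elim_inr, negPart_eq_neg.mpr h, ← hj, hinl j h, zero_sub, neg_neg]
  · rw [hinr j h, signedPoint, Sum.elim_inr, negPart_eq_zero.mpr h]

theorem abs_le_vertexBound_of_linearIndepOn {J : Finset (Fin n)}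
    (hJ : LinearIndepOn ℝ (fun j => castVec ℝ (χ j)) J) {a : Fin n → ℝ} (ha : ∀ j ∉ J, a j = 0)
    (hsum : ∑ j, a j • castVec ℝ (χ j) = castVec ℝ δ) (j : Fin n) : |a j| ≤ vertexBound χ δ := by
  have h := abs_le_vertexBound χ δ (signedPoint_mem_extremePoints hJ ha hsum)
  rcases le_total (a j) 0 with hj | hj
  · simpa [signedPoint, negPart_eq_neg.mpr hj] using h (Sum.inr j)
  · simpa [signedPoint, posPart_eq_self.mpr hj] using h (Sum.inl j)

theorem exists_bounded_coordinates {J : Finset (Fin n)} (hJ : J.card = d)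
    (hspan : Submodule.span ℤ (χ '' J) = ⊤) (δ : Fin d → ℤ) :
    ∃ a : Fin n → ℤ, (∀ j ∉ J, a j = 0) ∧ ∑ j, a j • χ j = δ ∧
      ∀ j, |(a j : ℝ)| ≤ vertexBound χ δ := by
  obtain ⟨a, ha, hsum⟩ := exists_sum_smul_eq_of_mem_span (hspan ▸ Submodule.mem_top : δ ∈ _)
  refine ⟨a, ha, hsum, abs_le_vertexBound_of_linearIndepOn
    (linearIndepOn_castVec hspan (by simpa using hJ)) (fun j hj => by simp [ha j hj]) ?_⟩
  simp only [← hsum, map_sum, castVec_smul]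

end VertexBound

/-! ### Generic characters -/

theorem exists_forall_dotProduct_ne_zero {ι κ R : Type*} [Fintype ι] [Finite κ] [CommRing R]
    [IsDomain R] [Infinite R] {b : κ → ι → R} (hb : ∀ i, b i ≠ 0) :
    ∃ a : ι → R, ∀ i, a ⬝ᵥ b i ≠ 0 := by
  classical
  cases nonempty_fintype κ
  let P : κ → MvPolynomial ι R := fun i => ∑ j, MvPolynomial.X j * MvPolynomial.C (b i j)
  have heval : ∀ a i, MvPolynomial.eval a (P i) = a ⬝ᵥ b i := fun a i => by
    simp [P, dotProduct]
  have hP : ∏ i, P i ≠ 0 := Finset.prod_ne_zero_iff.mpr fun i _ hi =>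
    hb i (dotProduct_eq_zero _ fun a => by rw [dotProduct_comm, ← heval, hi, map_zero])
  by_contra! h
  refine hP (MvPolynomial.funext fun a => ?_)
  obtain ⟨i, hi⟩ := h a
  rw [map_prod, map_zero]
  exact Finset.prod_eq_zero (Finset.mem_univ i) ((heval a i).trans hi)

section Generic

variable {n d : ℕ}

theorem exists_isGeneric (χ : Fin n → Fin d → ℤ) : ∃ δ, IsGeneric χ δ := by
  choose b hb hb_zero using fun I : {I // subCochar χ I ≠ ⊥} =>
    Submodule.exists_mem_ne_zero_of_ne_bot I.2
  obtain ⟨δ, hδ⟩ := exists_forall_dotProduct_ne_zero hb_zero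
  have hwall : ∀ I, subCochar χ I ≠ ⊥ → δ ∉ wall χ I := fun I hI hδI =>
    hδ ⟨I, hI⟩ (hδI _ (hb ⟨I, hI⟩))
  refine ⟨δ, fun I hI => hwall I fun hbot => ?_, fun I hI hδI => ?_⟩
  · rw [hbot, finrank_bot] at hI
    exact zero_ne_one hI
  · exact hwall I (fun hbot => hI.not_ge (le_card_of_subCochar_eq_bot hbot))
      (mem_wall_of_mem_span hδI)

theorem exists_isGeneric_vertexBound_mem (χ : Fin n → Fin d → ℤ) {s : Set ℝ} (hs : IsOpen s)
    (hmem : minBound χ ∈ s) : ∃ δ, IsGeneric χ δ ∧ vertexBound χ δ ∈ s := by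
  obtain ⟨δ₀, hδ₀⟩ := exists_isGeneric χ
  have hclosure : minBound χ ∈ closure {r | ∃ δ, IsGeneric χ δ ∧ r = vertexBound χ δ} := by
    refine csInf_mem_closure ⟨_, δ₀, hδ₀, rfl⟩ ⟨0, ?_⟩
    rintro _ ⟨δ, -, rfl⟩
    exact vertexBound_nonneg χ δ
  obtain ⟨_, hr, δ, hδ, rfl⟩ := mem_closure_iff.mp hclosure s hs hmem
  exact ⟨δ, hδ, hr⟩

theorem span_image_eq_top_of_isGeneric {χ : Fin n → Fin d → ℤ}
    (hspan : Submodule.span ℤ (Set.range χ) = ⊤) (hunimod : IsUnimodular χ) {δ : Fin d → ℤ}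
    (hδ : IsGeneric χ δ) {S : Set (Fin n)} {r : ℤ} (hr : r ≠ 0)
    (hδS : r • δ ∈ Submodule.span ℤ (χ '' S)) : Submodule.span ℤ (χ '' S) = ⊤ := by
  obtain ⟨I, J, hIJ, hIS, hJcard, hJ, htop, hSI⟩ := exists_linearIndepOn_span_eq_top hspan hunimod S
  have hle : Submodule.span ℤ (χ '' S) ≤ Submodule.span ℤ (χ '' I) :=
    Submodule.span_le.mpr (Set.image_subset_iff.mpr hSI)
  have hδI : δ ∈ Submodule.span ℤ (χ '' I) := mem_span_image_of_smul_mem hJ htop hIJ hr (hle hδS)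
  have hIcard : d ≤ I.card := not_lt.mp fun h => hδ.2 I h hδI
  obtain rfl : I = J := Finset.eq_of_subset_of_card_le hIJ (hJcard.trans_le hIcard)
  exact eq_top_mono (Submodule.span_mono (Set.image_mono hIS)) htop

end Generic

/-! ### Smooth parameters -/

theorem coeff_aeval_C_mul_X {σ R : Type*} [Fintype σ] [CommRing R] (u : σ → R)
    (s : MvPolynomial σ R) (m : σ →₀ ℕ) :
    (MvPolynomial.aeval (fun c => MvPolynomial.C (u c) * MvPolynomial.X c) s).coeff m =
      (∏ c, u c ^ m c) * s.coeff m := by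
  classical
  induction s using MvPolynomial.induction_on' with
  | monomial e a =>
    have hmonomial : MvPolynomial.aeval (fun c => MvPolynomial.C (u c) * MvPolynomial.X c)
        (MvPolynomial.monomial e a) =
          MvPolynomial.C (∏ c, u c ^ e c) * MvPolynomial.monomial e a := by
      rw [MvPolynomial.aeval_monomial, MvPolynomial.monomial_eq,
        Finsupp.prod_fintype _ _ (fun _ => pow_zero _),
        Finsupp.prod_fintype _ _ (fun _ => pow_zero _)]
      simp only [mul_pow, Finset.prod_mul_distrib, map_prod, map_pow, MvPolynomial.algebraMap_eq]
      ring
    rw [hmonomial, MvPolynomial.coeff_C_mul, MvPolynomial.coeff_monomial]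
    split_ifs with h
    · rw [h]
    · simp
  | add p q hp hq => rw [map_add, MvPolynomial.coeff_add, hp, hq, MvPolynomial.coeff_add, mul_add]

section Characters

variable {R : Type*} [CommRing R] {n d : ℕ}

theorem chr_single (i : Fin d) (t : Fin d → Rˣ) : chr (Pi.single i 1) t = t i := by
  rw [chr, Finset.prod_eq_single i (fun j _ hj => by simp [hj]) (by simp), Pi.single_eq_same,
    zpow_one]

theorem chr_sum_nsmul {ι : Type*} (s : Finset ι) (m : ι → ℕ) (w : ι → Fin d → ℤ)
    (t : Fin d → Rˣ) : chr (∑ c ∈ s, m c • w c) t = ∏ c ∈ s, chr (w c) t ^ m c := by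
  let φ : (Fin d → ℤ) →+ Additive Rˣ := AddMonoidHom.mk' (fun a => .ofMul (chr a t))
    fun a b => congrArg Additive.ofMul (chr_add a b t)
  exact congrArg Additive.toMul
    ((map_sum φ _ s).trans (Finset.sum_congr rfl fun c _ => map_nsmul φ (m c) (w c)))

theorem weight_mem_iff (χ : Fin n → Fin d → ℤ) (H : Submodule ℤ (Fin d → ℤ))
    (c : Fin n ⊕ Fin n) : weight χ c ∈ H ↔ χ (Sum.elim id id c) ∈ H := by
  rcases c with j | j
  · rfl
  · exact neg_mem_iff

/-- The characters of the torus that act trivially on an element `r` of `R` at the point `t`. -/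
def fixingCharacters (t : Fin d → Rˣ) (r : R) : Submodule ℤ (Fin d → ℤ) :=
  AddSubgroup.toIntSubmodule
    { carrier := {a | ((chr a t : Rˣ) : R) * r = r}
      zero_mem' := by simp [chr_zero]
      add_mem' := fun {a b} ha hb => by
        rw [Set.mem_ofPred_eq] at ha hb ⊢
        rw [chr_add, Units.val_mul, mul_assoc, hb, ha]
      neg_mem' := fun {a} ha => by
        rw [Set.mem_ofPred_eq, chr_neg, Units.inv_mul_eq_iff_eq_mul]
        exact ha.symm }

theorem mem_fixingCharacters {t : Fin d → Rˣ} {r : R} {a : Fin d → ℤ} :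
    a ∈ fixingCharacters t r ↔ ((chr a t : Rˣ) : R) * r = r :=
  Iff.rfl

theorem fixingCharacters_prod_pow_eq_top {χ : Fin n → Fin d → ℤ}
    (hspan : Submodule.span ℤ (Set.range χ) = ⊤) (hunimod : IsUnimodular χ) {δ : Fin d → ℤ}
    (hδ : IsGeneric χ δ) {m : ℕ} (hm : 0 < m) {e : Fin n ⊕ Fin n →₀ ℕ}
    (he : ∑ c, e c • weight χ c = m • δ) {t : Fin d → Rˣ} {y : Fin n ⊕ Fin n → R}
    (ht : actPoint χ t y = y) : fixingCharacters t (∏ c, y c ^ e c) = ⊤ := by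
  let S : Set (Fin n) := {j | ∃ c, e c ≠ 0 ∧ Sum.elim id id c = j}
  have hδS : (m : ℤ) • δ ∈ Submodule.span ℤ (χ '' S) := by
    rw [natCast_zsmul, ← he]
    refine sum_mem fun c _ => ?_
    by_cases hc : e c = 0
    · simp [hc]
    · refine nsmul_mem ((weight_mem_iff χ _ c).mpr (Submodule.subset_span ?_)) _
      exact ⟨_, ⟨c, hc, rfl⟩, rfl⟩
  rw [eq_top_iff, ← span_image_eq_top_of_isGeneric hspan hunimod hδ (by simpa using hm.ne') hδS,
    Submodule.span_le]
  rintro _ ⟨_, ⟨c, hc, rfl⟩, rfl⟩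
  obtain ⟨z, hz⟩ := (dvd_pow_self (y c) hc).trans
    (Finset.dvd_prod_of_mem (fun c => y c ^ e c) (Finset.mem_univ c))
  refine (weight_mem_iff χ _ c).mp (mem_fixingCharacters.mpr ?_)
  rw [hz, ← mul_assoc]
  exact congrArg (· * z) (congrFun ht c)

end Characters

section SmoothParameter

variable {k : Type*} [Field k] [Infinite k] {n d : ℕ} {χ : Fin n → Fin d → ℤ}

theorem sum_smul_weight_of_mem_support {a : Fin d → ℤ} {s : MvPolynomial (Fin n ⊕ Fin n) k}
    (hs : s ∈ semiInvFun k χ a) {e : Fin n ⊕ Fin n →₀ ℕ} (he : e ∈ s.support) :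
    ∑ c, e c • weight χ c = a := by
  refine chr_injective k d (funext fun t => ?_)
  have hcoeff := congrArg (MvPolynomial.coeff e) (hs t)
  rw [coeff_aeval_C_mul_X, MvPolynomial.coeff_C_mul] at hcoeff
  dsimp only
  rw [← mul_right_cancel₀ (MvPolynomial.mem_support_iff.mp he) hcoeff, chr_sum_nsmul]
  simp

theorem isSmoothParameter_of_isGeneric (hspan : Submodule.span ℤ (Set.range χ) = ⊤)
    (hunimod : IsUnimodular χ) {δ : Fin d → ℤ} (hδ : IsGeneric χ δ) :
    IsSmoothParameter k χ δ := by
  intro R _ _ y _ hss t ht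
  ext i
  let J : Ideal R := LinearMap.ker (LinearMap.mulLeft R ((t i : R) - 1))
  have hJ : J = ⊤ := by
    rw [eq_top_iff, ← show Ideal.span _ = ⊤ from hss, Ideal.span_le]
    rintro _ ⟨m, hm, s, hs, rfl⟩
    rw [MvPolynomial.aeval_def, MvPolynomial.eval₂_eq']
    refine sum_mem fun e he => Ideal.mul_mem_left _ _ ?_
    have htop := fixingCharacters_prod_pow_eq_top hspan hunimod hδ hm
      (sum_smul_weight_of_mem_support hs he) ht
    have hfix := mem_fixingCharacters.mp (htop ▸ Submodule.mem_top : Pi.single i 1 ∈ _)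
    rw [chr_single] at hfix
    rw [LinearMap.mem_ker, LinearMap.mulLeft_apply, sub_mul, one_mul, hfix, sub_self]
  have hone : (1 : R) ∈ J := hJ ▸ Submodule.mem_top
  simpa [J, sub_eq_zero] using hone

end SmoothParameter

/-! ### Euler operators -/

section Euler

open scoped IsMulCommutative

variable (k : Type*) [Field k] {n : ℕ}

/-- The Euler operator `x_j ∂_j`. -/
def euler (j : Fin n) : Weyl k n :=
  gen k (Sum.inl j) * gen k (Sum.inr j)

theorem euler_mul_x (i j : Fin n) :
    euler k i * gen k (Sum.inl j) = gen k (Sum.inl j) * (euler k i + if i = j then 1 else 0) := by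
  rw [euler, mul_assoc, gen_dx, mul_add, ← mul_assoc, gen_xx k i j, mul_assoc, mul_add]
  split_ifs with h
  · rw [h]
  · simp

theorem euler_mul_d (i j : Fin n) :
    euler k i * gen k (Sum.inr j) = gen k (Sum.inr j) * (euler k i - if i = j then 1 else 0) := by
  rw [euler, mul_sub, ← mul_assoc (gen k (Sum.inr j)), gen_dx, mul_assoc, gen_dd k i j, add_mul,
    mul_assoc]
  rcases eq_or_ne i j with rfl | h
  · simp
  · simp [h, h.symm]

variable {k} in
theorem commute_euler_gen {i : Fin n} {c : Fin n ⊕ Fin n} (h : i ≠ Sum.elim id id c) :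
    Commute (euler k i) (gen k c) := by
  rcases c with j | j
  · exact (euler_mul_x k i j).trans (by rw [if_neg (by exact h), add_zero])
  · exact (euler_mul_d k i j).trans (by rw [if_neg (by exact h), sub_zero])

theorem commute_euler (i j : Fin n) : Commute (euler k i) (euler k j) := by
  rcases eq_or_ne i j with rfl | h
  · exact Commute.refl _
  · exact (commute_euler_gen h).mul_right (commute_euler_gen h)

theorem euler_mul_x_pow (j : Fin n) (m : ℕ) :
    euler k j * gen k (Sum.inl j) ^ m = gen k (Sum.inl j) ^ m * (euler k j + m) := by
  induction m with
  | zero => simp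
  | succ m ih =>
    rw [pow_succ, ← mul_assoc, ih, mul_assoc, add_mul, euler_mul_x, if_pos rfl,
      ← (Nat.cast_commute m _).eq.symm, ← mul_add, ← mul_assoc, Nat.cast_succ, add_assoc,
      add_comm 1]

theorem euler_mul_d_pow (j : Fin n) (m : ℕ) :
    euler k j * gen k (Sum.inr j) ^ m = gen k (Sum.inr j) ^ m * (euler k j - m) := by
  induction m with
  | zero => simp
  | succ m ih =>
    rw [pow_succ, ← mul_assoc, ih, mul_assoc, sub_mul, euler_mul_d, if_pos rfl,
      ← (Nat.cast_commute m _).eq.symm, ← mul_sub, ← mul_assoc, Nat.cast_succ, sub_sub,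
      add_comm 1]

/-- The commutative subalgebra of the Weyl algebra generated by the Euler operators. -/
def eulerAlgebra (n : ℕ) : Subalgebra k (Weyl k n) :=
  Algebra.adjoin k (Set.range (euler k))

instance (n : ℕ) : IsMulCommutative (eulerAlgebra k n) := by
  refine Algebra.isMulCommutative_adjoin k ?_
  rintro _ ⟨i, rfl⟩ _ ⟨j, rfl⟩
  exact commute_euler k i j

/-- The Euler operator `x_j ∂_j`, as an element of the commutative algebra it belongs to. -/
def eulerElt (j : Fin n) : eulerAlgebra k n :=
  ⟨euler k j, Algebra.subset_adjoin ⟨j, rfl⟩⟩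

@[simp]
theorem coe_eulerElt (j : Fin n) : (eulerElt k j : Weyl k n) = euler k j :=
  rfl

/-- The integers `r` for which `x_j ∂_j - r` is a factor of `∂_j ^ a x_j ^ a`, if `a ≥ 0`, and of
`x_j ^ (-a) ∂_j ^ (-a)`, if `a ≤ 0`; at least one of the two intervals is empty. -/
noncomputable def eulerRoots (a : ℤ) : Finset ℤ :=
  Finset.Ico (-a) 0 ∪ Finset.Ico 0 (-a)

/-- The operator `∂_j ^ a x_j ^ a`, if `a ≥ 0`, and `x_j ^ (-a) ∂_j ^ (-a)`, if `a ≤ 0`, as a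
polynomial in the Euler operator `x_j ∂_j`. -/
noncomputable def eulerProd (j : Fin n) (a : ℤ) : eulerAlgebra k n :=
  ∏ r ∈ eulerRoots a, (eulerElt k j - r)

theorem d_pow_mul_x_pow (j : Fin n) (m : ℕ) :
    gen k (Sum.inr j) ^ m * gen k (Sum.inl j) ^ m = eulerProd k j m := by
  have hroots : ∀ m : ℕ, eulerRoots m = Finset.Ico (-m : ℤ) 0 := fun m => by
    rw [eulerRoots, Finset.Ico_eq_empty_of_le (a := (0 : ℤ)) (by simp), Finset.union_empty]
  induction m with
  | zero => simp [eulerProd, eulerRoots]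
  | succ m ih =>
    have hsucc : eulerProd k j (m + 1 : ℕ) = eulerProd k j m * (eulerElt k j + (m + 1 : ℕ)) := by
      rw [eulerProd, hroots, eulerProd, hroots, Nat.cast_succ, neg_add',
        ← Finset.insert_Ico_left_eq_Ico_sub_one (by simp), Finset.prod_insert (by simp), mul_comm]
      congr 1
      push_cast
      ring
    rw [hsucc, Subalgebra.coe_mul, ← ih, pow_succ, pow_succ', mul_assoc,
      ← mul_assoc (gen k (Sum.inr j)) (gen k (Sum.inl j)), gen_dx, if_pos rfl, ← euler, add_mul,
      one_mul, euler_mul_x_pow, mul_assoc]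
    simp [mul_add, add_assoc]

theorem x_pow_mul_d_pow (j : Fin n) (m : ℕ) :
    gen k (Sum.inl j) ^ m * gen k (Sum.inr j) ^ m = eulerProd k j (-m) := by
  have hroots : ∀ m : ℕ, eulerRoots (-m) = Finset.Ico (0 : ℤ) m := fun m => by
    rw [eulerRoots, neg_neg, Finset.Ico_eq_empty_of_le (b := (0 : ℤ)) (by simp),
      Finset.empty_union]
  induction m with
  | zero => simp [eulerProd, eulerRoots]
  | succ m ih =>
    have hsucc : eulerProd k j (-(m + 1 : ℕ)) = eulerProd k j (-m) * (eulerElt k j - m) := by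
      rw [eulerProd, hroots, eulerProd, hroots, Nat.cast_succ,
        ← Finset.insert_Ico_right_eq_Ico_add_one (by simp), Finset.prod_insert (by simp), mul_comm,
        Int.cast_natCast]
    rw [hsucc, Subalgebra.coe_mul, ← ih, pow_succ, pow_succ', mul_assoc,
      ← mul_assoc (gen k (Sum.inl j)) (gen k (Sum.inr j)), ← euler, euler_mul_d_pow, mul_assoc]
    rfl

end Euler

/-! ### Operators of a given weight -/

section WeightSpace

open scoped IsMulCommutative

variable {k : Type*} [Field k] {n d : ℕ} (χ : Fin n → Fin d → ℤ)

instance : SetLike.GradedMonoid (weightSpace k χ) where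
  one_mem := ⟨fun t => by simp [chr_zero], fun θ => by simp [dchr_zero]⟩
  mul_mem a b P Q hP hQ := by
    refine ⟨fun t => ?_, fun θ => ?_⟩
    · rw [map_mul, hP.1, hQ.1, smul_mul_smul_comm, chr_add, Units.val_mul]
    · rw [dchr_add, add_smul, ← smul_mul_assoc, ← hP.2 θ, ← mul_smul_comm (dchr b θ), ← hQ.2 θ]
      noncomm_ring

theorem gen_mem_weightSpace (c : Fin n ⊕ Fin n) : gen k c ∈ weightSpace k χ (weight χ c) := by
  simpa using weightSpace_mul_gen χ (SetLike.GradedOne.one_mem (A := weightSpace k χ)) c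

theorem eulerAlgebra_le_weightSpace_zero :
    (eulerAlgebra k n).toSubmodule ≤ weightSpace k χ 0 := by
  change eulerAlgebra k n ≤ SetLike.GradeZero.subalgebra (weightSpace k χ)
  refine Algebra.adjoin_le ?_
  rintro _ ⟨j, rfl⟩
  have hj := SetLike.mul_mem_graded (gen_mem_weightSpace (k := k) χ (Sum.inl j))
    (gen_mem_weightSpace χ (Sum.inr j))
  rwa [weight, Sum.elim_inl, Sum.elim_inr, add_neg_cancel] at hj

variable (k)

theorem exists_mul_eq_eulerProd (j : Fin n) (a : ℤ) :
    ∃ P ∈ weightSpace k χ (-(a • χ j)), ∃ Q ∈ weightSpace k χ (a • χ j),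
      P * Q = eulerProd k j a ∧ ∀ i, i ≠ j → Commute (euler k i) Q := by
  have hx (m : ℕ) := SetLike.pow_mem_graded m (gen_mem_weightSpace (k := k) χ (Sum.inl j))
  have hd (m : ℕ) := SetLike.pow_mem_graded m (gen_mem_weightSpace (k := k) χ (Sum.inr j))
  simp only [weight, Sum.elim_inl, Sum.elim_inr, smul_neg, ← natCast_zsmul] at hx hd
  obtain ⟨m, rfl | rfl⟩ := a.eq_nat_or_neg
  · exact ⟨_, hd m, _, hx m, d_pow_mul_x_pow k j m,
      fun i hi => (commute_euler_gen hi).pow_right m⟩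
  · simp only [neg_smul, neg_neg]
    exact ⟨_, hx m, _, hd m, x_pow_mul_d_pow k j m,
      fun i hi => (commute_euler_gen hi).pow_right m⟩

variable {k} in
theorem commute_eulerProd {Q : Weyl k n} {j : Fin n} (hQ : Commute (euler k j) Q) (a : ℤ) :
    Commute (eulerProd k j a : Weyl k n) Q := by
  let C := (Subalgebra.centralizer k {Q}).comap (eulerAlgebra k n).val
  have hmem : ∀ {e : eulerAlgebra k n}, e ∈ C ↔ Commute (e : Weyl k n) Q := fun {e} => by
    simp [C, Subalgebra.mem_centralizer_iff, Commute, SemiconjBy, eq_comm]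
  exact hmem.mp (prod_mem fun r _ => sub_mem (hmem.mpr hQ) (intCast_mem C r))

theorem exists_mul_eq_prod_eulerProd (a : Fin n → ℤ) (s : Finset (Fin n)) :
    ∃ P ∈ weightSpace k χ (-∑ j ∈ s, a j • χ j), ∃ Q ∈ weightSpace k χ (∑ j ∈ s, a j • χ j),
      P * Q = (∏ j ∈ s, eulerProd k j (a j) : eulerAlgebra k n) ∧
        ∀ i ∉ s, Commute (euler k i) Q := by
  have hone : (1 : Weyl k n) ∈ weightSpace k χ 0 := SetLike.GradedOne.one_mem
  induction s using Finset.induction_on with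
  | empty =>
    exact ⟨1, by simpa using hone, 1, by simpa using hone, by simp, fun i _ => Commute.one_right _⟩
  | insert j s hj ih =>
    obtain ⟨P, hP, Q, hQ, hPQ, hcomm⟩ := ih
    obtain ⟨P', hP', Q', hQ', hPQ', hcomm'⟩ := exists_mul_eq_eulerProd k χ j (a j)
    rw [Finset.sum_insert hj, Finset.prod_insert hj]
    refine ⟨P * P', ?_, Q' * Q, SetLike.mul_mem_graded hQ' hQ, ?_, fun i hi => ?_⟩
    · rw [neg_add_rev]
      exact SetLike.mul_mem_graded hP hP'
    · rw [mul_assoc, ← mul_assoc P', hPQ', (commute_eulerProd (hcomm j hj) _).eq, ← mul_assoc,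
        hPQ, ← Subalgebra.coe_mul, mul_comm]
    · rw [Finset.mem_insert, not_or] at hi
      exact (hcomm' i hi.1).mul_right (hcomm i hi.2)

end WeightSpace

/-! ### A criterion for the surjection relation -/

section Criterion

universe u

variable {k : Type u} [Field k] {n d : ℕ} {χ : Fin n → Fin d → ℤ} {Λ δ : Fin d → ℤ}

theorem cls_mem_semiInv {a : Fin d → ℤ} {P : Weyl k n} (hP : P ∈ weightSpace k χ a) :
    cls χ Λ P ∈ semiInv k χ Λ a := fun t => by
  rw [actQuot_cls, hP.1, map_smul]

theorem transferLE_of_one_mem [Infinite k]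
    (h : 1 ∈ weightSpace k χ (-δ) * weightSpace k χ δ ⊔ rightIdeal k χ Λ) :
    TransferLE k χ Λ (Λ + δ) := by
  intro u
  obtain ⟨S, hS, hSu⟩ := semiInv_lift χ u.2
  have hrange : weightSpace k χ (-δ) * weightSpace k χ δ ≤
      (LinearMap.range ((U k χ Λ).subtype ∘ₗ transferMap k χ Λ (Λ + δ))).comap
        (cls χ Λ ∘ₗ LinearMap.mulRight k S) := by
    refine Submodule.mul_le.mpr fun P hP Q hQ => ?_
    have hP' : cls χ Λ P ∈ B k χ Λ (Λ + δ) := cls_mem_semiInv (by simpa using hP)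
    have hQ' : cls χ (Λ + δ) (Q * S) ∈ B k χ (Λ + δ) Λ :=
      cls_mem_semiInv (by simpa using SetLike.mul_mem_graded hQ hS)
    refine ⟨Submodule.Quotient.mk (⟨_, hP'⟩ ⊗ₜ[k] ⟨_, hQ'⟩), ?_⟩
    rw [LinearMap.comp_apply _ _ (P * Q), LinearMap.mulRight_apply, mul_assoc]
    exact mulB_coe χ Λ (Λ + δ) Λ ⟨_, hP'⟩ ⟨_, hQ'⟩ P (Q * S) rfl rfl
  obtain ⟨V, hV, W, hW, hVW⟩ := Submodule.mem_sup.mp h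
  obtain ⟨z, hz⟩ := hrange hV
  have hWS : cls χ Λ (W * S) = 0 := (cls_eq_zero χ Λ).mpr (rightIdeal_mul_mem χ hW S)
  have hVS : V * S = S - W * S := by rw [eq_sub_iff_add_eq, ← add_mul, hVW, one_mul]
  refine ⟨z, Subtype.ext (hz.trans ?_)⟩
  rw [LinearMap.comp_apply, LinearMap.mulRight_apply, hVS, map_sub, hWS, sub_zero, hSu]

open scoped IsMulCommutative

variable (k χ Λ δ) in
/-- The ideal of those polynomials in the Euler operators whose class in `U_λ`, `λ = dΛ`, is in the
image of the multiplication map which decides whether `Λ ≤ Λδ`. -/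
def transferIdeal : Ideal (eulerAlgebra k n) where
  toAddSubmonoid := ((weightSpace k χ (-δ) * weightSpace k χ δ ⊔ rightIdeal k χ Λ).comap
    (eulerAlgebra k n).val.toLinearMap).toAddSubmonoid
  smul_mem' e f hf := by
    have he : (e : Weyl k n) ∈ weightSpace k χ 0 := eulerAlgebra_le_weightSpace_zero χ e.2
    obtain ⟨V, hV, W, hW, hVW⟩ := Submodule.mem_sup.mp hf
    have hmul : weightSpace k χ 0 * (weightSpace k χ (-δ) * weightSpace k χ δ) ≤
        weightSpace k χ (-δ) * weightSpace k χ δ := by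
      rw [← mul_assoc]
      refine mul_le_mul_left (Submodule.mul_le.mpr fun P hP Q hQ => ?_) _
      simpa only [zero_add] using SetLike.mul_mem_graded hP hQ
    change (e * f : Weyl k n) ∈ _ ⊔ rightIdeal k χ Λ
    rw [← show V + W = f from hVW, mul_add]
    exact Submodule.add_mem_sup (hmul (Submodule.mul_mem_mul he hV))
      (mul_mem_rightIdeal χ (by rwa [sub_self]) hW)

theorem prod_eulerProd_mem_transferIdeal {a : Fin n → ℤ} (ha : ∑ j, a j • χ j = δ) :
    ∏ j, eulerProd k j (a j) ∈ transferIdeal k χ Λ δ := by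
  obtain ⟨P, hP, Q, hQ, hPQ, -⟩ := exists_mul_eq_prod_eulerProd k χ a Finset.univ
  rw [ha] at hP hQ
  have hmem := Submodule.mul_mem_mul hP hQ
  rw [hPQ] at hmem
  exact Submodule.mem_sup_left hmem

theorem sum_smul_eulerElt_sub_mem_transferIdeal (i : Fin d) :
    ∑ j, (χ j i : k) • eulerElt k j - algebraMap k _ (Λ i : k) ∈ transferIdeal k χ Λ δ := by
  refine Submodule.mem_sup_right (Submodule.subset_span ⟨Pi.single i 1, 1, ?_⟩)
  have hdchr (a : Fin d → ℤ) : dchr a (Pi.single i 1 : Fin d → k) = a i := by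
    simp [dchr, Pi.single_apply]
  simp [comoment, hdchr, euler]

/-- Nullstellensatz: `z` is a point of `Spec k[x_1 ∂_1, …, x_n ∂_n]`, with values in a residue field
that may be larger than `k`. -/
theorem transferLE_of_forall_exists [Infinite k]
    (h : ∀ (K : Type u) [Field K] [Algebra k K] (z : Fin n → K),
      (∀ i, ∑ j, (χ j i : K) * z j = Λ i) →
        ∃ a : Fin n → ℤ, ∑ j, a j • χ j = δ ∧ ∀ j, ∀ r ∈ eulerRoots (a j), z j ≠ r) :
    TransferLE k χ Λ (Λ + δ) := by
  refine transferLE_of_one_mem ((transferIdeal k χ Λ δ).eq_top_iff_one.mp ?_)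
  by_contra htop
  obtain ⟨m, hm, hle⟩ := Ideal.exists_le_maximal _ htop
  let := Ideal.Quotient.field m
  obtain ⟨a, ha, hroots⟩ := h (eulerAlgebra k n ⧸ m) (fun j => Ideal.Quotient.mk m (eulerElt k j))
    fun i => by
      have := Ideal.Quotient.eq_zero_iff_mem.mpr
        (hle (sum_smul_eulerElt_sub_mem_transferIdeal (k := k) (χ := χ) (Λ := Λ) (δ := δ) i))
      simpa [sub_eq_zero, Algebra.smul_def] using this
  have hzero := Ideal.Quotient.eq_zero_iff_mem.mpr
    (hle (prod_eulerProd_mem_transferIdeal (k := k) (Λ := Λ) ha))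
  simp only [eulerProd, map_prod, Finset.prod_eq_zero_iff, map_sub, map_intCast, sub_eq_zero]
    at hzero
  obtain ⟨j, -, r, hr, hjr⟩ := hzero
  exact hroots j r hr hjr

end Criterion

/-! ### Counting linear combinations over a finite field -/

theorem exists_forall_sum_smul_ne {F ι M : Type*} [Fintype F] [Fintype ι] [Finite M] [Semiring F]
    [AddCommMonoid M] [Module F M] (v : ι → M) (R : Finset F) (m : ℕ)
    (h : (Fintype.card ι).choose m * R.card ^ (Fintype.card ι - m) * Fintype.card F ^ m <
      Nat.card M) :
    ∃ x : M, ∀ I : Finset ι, I.card = m → ∀ c : ι → F, (∀ j ∉ I, c j ∈ R) →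
      ∑ j, c j • v j ≠ x := by
  classical
  cases nonempty_fintype M
  let C (I : Finset ι) : Finset (ι → F) := Fintype.piFinset fun j => if j ∈ I then .univ else R
  have hC : ∀ I ∈ Finset.univ.powersetCard m, ((C I).image fun c => ∑ j, c j • v j).card ≤
      R.card ^ (Fintype.card ι - m) * Fintype.card F ^ m := by
    intro I hI
    obtain rfl := (Finset.mem_powersetCard.mp hI).2
    refine Finset.card_image_le.trans_eq ?_
    simp only [C, Fintype.card_piFinset, apply_ite Finset.card, Finset.prod_ite,
      Finset.prod_const, Finset.card_univ, Finset.filter_univ_mem, Finset.filter_notMem_eq_sdiff,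
      Finset.card_univ_sdiff, mul_comm]
  by_contra! hx
  have hcover : (Finset.univ : Finset M) =
      (Finset.univ.powersetCard m).biUnion fun I => (C I).image fun c => ∑ j, c j • v j := by
    refine (Finset.eq_univ_of_forall fun x => ?_).symm
    obtain ⟨I, hI, c, hc, rfl⟩ := hx x
    refine Finset.mem_biUnion.mpr ⟨I, by simpa using hI, Finset.mem_image_of_mem _ ?_⟩
    refine Fintype.mem_piFinset.mpr fun j => ?_
    split_ifs with hj
    exacts [Finset.mem_univ _, hc j hj]
  refine h.not_ge ?_
  rw [Nat.card_eq_fintype_card, ← Finset.card_univ, hcover, mul_assoc]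
  simpa using Finset.card_biUnion_le_card_mul _ _ _ hC

theorem exists_sum_smul_eq_of_forall_mem_span {ι F M : Type*} [Fintype ι] [CommRing F]
    [AddCommGroup M] [Module F M] {v : ι → M} {S : Set ι} {I : Finset ι}
    (hS : ∀ j ∈ S, v j ∈ Submodule.span F (v '' I)) (w : ι → F) :
    ∃ c : ι → F, ∑ j, c j • v j = ∑ j, w j • v j ∧ ∀ j ∉ I, c j = Sᶜ.indicator w j := by
  have hmem : ∑ j, S.indicator w j • v j ∈ Submodule.span F (v '' I) := by
    refine Submodule.sum_mem _ fun j _ => ?_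
    by_cases hj : j ∈ S
    · exact Submodule.smul_mem _ _ (hS j hj)
    · simp [hj]
  obtain ⟨b, hb, hsum⟩ := exists_sum_smul_eq_of_mem_span hmem
  refine ⟨b + Sᶜ.indicator w, ?_, fun j hj => by simp [hb j hj]⟩
  simp only [Pi.add_apply, add_smul, Finset.sum_add_distrib, hsum]
  simp only [← Finset.sum_add_distrib, ← add_smul, Set.indicator_self_add_compl_apply]

theorem exists_sum_smul_eq_of_algebraMap {F K ι κ : Type*} [Field F] [Ring K] [Nontrivial K]
    [Algebra F K] [Fintype ι] {v : ι → κ → F} {x : κ → F} {z : ι → K}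
    (hz : ∀ i, ∑ j, v j i • z j = algebraMap F K (x i)) :
    ∃ w : ι → F, ∑ j, w j • v j = x ∧ ∀ j r, z j = algebraMap F K r → w j = r := by
  obtain ⟨f, hf⟩ := (Algebra.linearMap F K).exists_leftInverse_of_injective
    (LinearMap.ker_eq_bot.mpr (algebraMap F K).injective)
  have hf' : ∀ r, f (algebraMap F K r) = r := LinearMap.congr_fun hf
  refine ⟨fun j => f (z j), ?_, fun j r hj => ?_⟩
  · ext i
    simpa [hf', mul_comm] using congrArg f (hz i)
  · exact (congrArg f hj).trans (hf' r)

/-! ### Existence of a comparable parameter -/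

section Transfer

variable {n d : ℕ} {χ : Fin n → Fin d → ℤ}

theorem exists_span_eq_top_forall_ne {F K : Type*} [Field F] [Ring K] [Nontrivial K] [Algebra F K]
    (hspan : Submodule.span ℤ (Set.range χ) = ⊤) (hunimod : IsUnimodular χ) {R : Set F}
    (hR : 0 ∈ R) {x : Fin d → F}
    (hx : ∀ I : Finset (Fin n), I.card = d - 1 → ∀ c : Fin n → F, (∀ j ∉ I, c j ∈ R) →
      ∑ j, c j • castVec F (χ j) ≠ x)
    {z : Fin n → K} (hz : ∀ i, ∑ j, castVec F (χ j) i • z j = algebraMap F K (x i)) :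
    ∃ J : Finset (Fin n), J.card = d ∧ Submodule.span ℤ (χ '' J) = ⊤ ∧
      ∀ j ∈ J, ∀ r ∈ R, z j ≠ algebraMap F K r := by
  let S := {j | ∀ r ∈ R, z j ≠ algebraMap F K r}
  obtain ⟨I, J, hIJ, hIS, hJcard, -, htop, hSI⟩ :=
    exists_linearIndepOn_span_eq_top hspan hunimod S
  rcases hIJ.eq_or_ssubset with rfl | hssub
  · exact ⟨I, hJcard, htop, fun j hj => hIS hj⟩
  exfalso
  obtain ⟨j₀, hj₀J, hj₀I⟩ := Finset.exists_of_ssubset hssub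
  obtain ⟨w, hw, hwz⟩ := exists_sum_smul_eq_of_algebraMap hz
  have hwR : ∀ j ∉ S, w j ∈ R := fun j hj => by
    obtain ⟨r, hr, hjr⟩ : ∃ r ∈ R, z j = algebraMap F K r := by simpa [S] using hj
    exact hwz j r hjr ▸ hr
  obtain ⟨c, hc, hcI⟩ := exists_sum_smul_eq_of_forall_mem_span
    (fun j hj => castVec_mem_span_image (F := F) (hSI j hj)) w
  refine hx (J.erase j₀) (by rw [Finset.card_erase_of_mem hj₀J, hJcard]) c (fun j hj => ?_)
    (hc.trans hw)
  have hjI : j ∉ I := fun h =>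
    hj (Finset.mem_erase.mpr ⟨fun h' => hj₀I (h' ▸ h), hIJ h⟩)
  rw [hcI j hjI]
  by_cases hjS : j ∈ S
  · simpa [hjS] using hR
  · simpa [hjS] using hwR j hjS

theorem eulerRoots_subset_Ico {a : ℤ} {M : ℕ} (ha : |a| ≤ M) :
    eulerRoots a ⊆ Finset.Ico (-M : ℤ) M := by
  rw [abs_le] at ha
  exact Finset.union_subset (Finset.Ico_subset_Ico (by lia) (by lia))
    (Finset.Ico_subset_Ico (by lia) (by lia))

theorem one_le_vertexBound (hspan : Submodule.span ℤ (Set.range χ) = ⊤)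
    (hunimod : IsUnimodular χ) {δ : Fin d → ℤ} (hδ : δ ≠ 0) : 1 ≤ vertexBound χ δ := by
  obtain ⟨-, J, -, -, hJcard, -, htop, -⟩ :=
    exists_linearIndepOn_span_eq_top hspan hunimod Set.univ
  obtain ⟨a, -, rfl, hbound⟩ := exists_bounded_coordinates hJcard htop δ
  obtain ⟨j, -, hj⟩ := Finset.exists_ne_zero_of_sum_ne_zero hδ
  refine le_trans ?_ (hbound j)
  exact_mod_cast Int.one_le_abs fun h : a j = 0 => hj (by rw [h, zero_smul])

theorem exists_forall_sum_smul_castVec_ne {p : ℕ} [Fact p.Prime] (hd : 0 < d)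
    (χ : Fin n → Fin d → ℤ) (M : ℕ) (hp : n.choose (d - 1) * (2 * M) ^ (n - (d - 1)) < p) :
    ∃ Λ : Fin d → ℤ, ∀ I : Finset (Fin n), I.card = d - 1 → ∀ c : Fin n → ZMod p,
      (∀ j ∉ I, c j ∈ Int.cast '' Set.Ico (-M : ℤ) M) →
        ∑ j, c j • castVec (ZMod p) (χ j) ≠ castVec (ZMod p) Λ := by
  let R : Finset (ZMod p) := (Finset.Ico (-M : ℤ) M).image Int.cast
  have hR : R.card ≤ 2 * M := Finset.card_image_le.trans (by rw [Int.card_Ico]; lia)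
  have hcard : n.choose (d - 1) * R.card ^ (n - (d - 1)) * p ^ (d - 1) < p ^ d := by
    rw [← mul_pow_sub_one hd.ne' p]
    gcongr
    · exact pow_pos (Fact.out : p.Prime).pos _
    · exact lt_of_le_of_lt (by gcongr) hp
  obtain ⟨x, hx⟩ := exists_forall_sum_smul_ne (fun j => castVec (ZMod p) (χ j)) R (d - 1)
    (by simpa using hcard)
  choose Λ hΛ using fun i => ZMod.intCast_surjective (x i)
  refine ⟨Λ, fun I hI c hc => ?_⟩
  rw [show castVec (ZMod p) Λ = x from funext hΛ]
  exact hx I hI c (by simpa [R] using hc)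

universe u

variable {k : Type u} [Field k] [Infinite k] {p : ℕ} [Fact p.Prime] [CharP k p] {δ : Fin d → ℤ}

theorem transferLE_of_forall_sum_smul_castVec_ne (hspan : Submodule.span ℤ (Set.range χ) = ⊤)
    (hunimod : IsUnimodular χ) {M : ℕ} (hM : 0 < M) (hδ : vertexBound χ δ < M + 1)
    {Λ : Fin d → ℤ}
    (hΛ : ∀ I : Finset (Fin n), I.card = d - 1 → ∀ c : Fin n → ZMod p,
      (∀ j ∉ I, c j ∈ Int.cast '' Set.Ico (-M : ℤ) M) →
        ∑ j, c j • castVec (ZMod p) (χ j) ≠ castVec (ZMod p) Λ) :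
    TransferLE k χ Λ (Λ + δ) := by
  refine transferLE_of_forall_exists fun K _ _ z hz => ?_
  have : CharP K p := charP_of_injective_algebraMap (algebraMap k K).injective p
  let := ZMod.algebra K p
  have hzero : (0 : ZMod p) ∈ Int.cast '' Set.Ico (-M : ℤ) M :=
    ⟨0, by simpa using hM, Int.cast_zero⟩
  obtain ⟨J, hJcard, htop, hzJ⟩ := exists_span_eq_top_forall_ne hspan hunimod hzero hΛ
    (z := z) (by simpa [Algebra.smul_def] using hz)
  obtain ⟨a, haJ, ha, hbound⟩ := exists_bounded_coordinates hJcard htop δ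
  refine ⟨a, ha, fun j r hr => ?_⟩
  by_cases hj : j ∈ J
  · have haj : |a j| ≤ M := Int.lt_add_one_iff.mp (by exact_mod_cast (hbound j).trans_lt hδ)
    have hrM := Finset.mem_Ico.mp (eulerRoots_subset_Ico haj hr)
    simpa using hzJ j hj r ⟨r, hrM, rfl⟩
  · simp [haJ j hj, eulerRoots] at hr

theorem exists_transferLE (hd : 0 < d) (hspan : Submodule.span ℤ (Set.range χ) = ⊤)
    (hunimod : IsUnimodular χ)
    (hp : (n.choose (d - 1) : ℝ) * (2 * vertexBound χ δ) ^ (n - d + 1) < p) :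
    ∃ Λ : Fin d → ℤ, TransferLE k χ Λ (Λ + δ) := by
  rcases eq_or_ne δ 0 with rfl | hδ
  · exact ⟨0, transferLE_of_forall_exists fun K _ _ z _ => ⟨0, by simp, by simp [eulerRoots]⟩⟩
  set M := ⌊vertexBound χ δ⌋₊
  have hM : (M : ℝ) ≤ vertexBound χ δ := Nat.floor_le (vertexBound_nonneg χ δ)
  have hdn : d ≤ n := by
    obtain ⟨-, J, -, -, rfl, -⟩ := exists_linearIndepOn_span_eq_top hspan hunimod Set.univ
    simpa using J.card_le_univ
  have hpM : n.choose (d - 1) * (2 * M) ^ (n - (d - 1)) < p := by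
    rw [show n - (d - 1) = n - d + 1 by lia, ← Nat.cast_lt (α := ℝ)]
    push_cast
    exact lt_of_le_of_lt (by gcongr) hp
  obtain ⟨Λ, hΛ⟩ := exists_forall_sum_smul_castVec_ne hd χ M hpM
  exact ⟨Λ, transferLE_of_forall_sum_smul_castVec_ne hspan hunimod
    (Nat.floor_pos.mpr (one_le_vertexBound hspan hunimod hδ)) (Nat.lt_floor_add_one _) hΛ⟩

end Transfer

end Hypertoric

theorem mainTheorem5_general (k : Type*) [Field k] [Infinite k] (p : ℕ) [Fact p.Prime] [CharP k p]
    (n d : ℕ) (hd : 0 < d) (χ : Fin n → Fin d → ℤ)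
    (hspan : Submodule.span ℤ (Set.range χ) = ⊤) (hunimod : Hypertoric.IsUnimodular χ)
    (hp : (n.choose (d - 1) : ℝ) * (2 * Hypertoric.minBound χ) ^ (n - d + 1) < p) :
    ∃ δ Λ : Fin d → ℤ,
      Hypertoric.IsSmoothParameter k χ δ ∧ Hypertoric.TransferLE k χ Λ (Λ + δ) := by
  have hopen : IsOpen {r : ℝ | (n.choose (d - 1) : ℝ) * (2 * r) ^ (n - d + 1) < p} :=
    isOpen_lt (by fun_prop) continuous_const
  obtain ⟨δ, hδ, hpδ⟩ := Hypertoric.exists_isGeneric_vertexBound_mem χ hopen hp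
  obtain ⟨Λ, hΛ⟩ := Hypertoric.exists_transferLE (k := k) hd hspan hunimod hpδ
  exact ⟨δ, Λ, Hypertoric.isSmoothParameter_of_isGeneric hspan hunimod hδ, hΛ⟩

theorem mainTheorem5 (k : Type*) [Field k] [IsAlgClosed k]
    (p : ℕ) [Fact p.Prime] [CharP k p]
    (n d : ℕ) (hd : 0 < d) (hdn : d < n)
    (χ : Fin n → Fin d → ℤ)
    (hspan : Submodule.span ℤ (Set.range χ) = ⊤)
    (hunimod : Hypertoric.IsUnimodular χ)
    (hp : (n.choose (d - 1) : ℝ) * (2 * Hypertoric.minBound χ) ^ (n - d + 1) < (p : ℝ)) :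
    ∃ δ Λ : Fin d → ℤ,
      Hypertoric.IsSmoothParameter k χ δ ∧ Hypertoric.TransferLE k χ Λ (Λ + δ) :=
  mainTheorem5_general k p n d hd χ hspan hunimod hp
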